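/- Let $\mathbb T=\mathbb R\cup\{-\infty\}$ be the max-plus semiring (addition $\max$, multiplication $+$), with its order topology, and let $\mathbb T^{n\times n}$ carry the tropical matrix product $(AB)_{ij}=\max_k(A_{ik}+B_{kj})$. Two matrices $A,B$ are equivalent if $B_{ij}=\lambda+A_{ij}$ for some $\lambda\in\mathbb R$ and all $i,j$; let $\pi:\mathbb T^{n\times n}\to\mathbb P\mathbb T^{n\times n}$ be the quotient map. The set $\mathbb P\mathbb T^{n\times n}$ carries the quotient topology on the classes of non-null matrices, and the class of the null matrix $(-\infty)$ is an isolated point. Let $\mathrm{rk}_\star$ denote any of the following notions of rank, all of which are constant on equivalence classes: - the tropical rank: the largest size of a tropically non-singular square submatrix, where an $r\times r$ matrix $B$ is singular if $B=(-\infty)$ with $r=1$, or if two distinct permutations $\sigma$ attain $\mathrm{per}(B)=\max_\sigma\sum_i B_{i\sigma(i)}$; - the symmetrized rank: the largest size of a square submatrix $B$ with $\det^+B\ne\det^-B$, where $\det^{\pm}$ is the same maximum over the even, respectively odd, permutations; - the Gondran–Minoux row and column ranks: the largest number of rows (columns) $x_1,\dots,x_r$ such that $\max_{i\in I}(\alpha_i+x_i)\neq\max_{j\in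 J}(\alpha_j+x_j)$ for all disjoint $I,J$ and all $\alpha_i\in\mathbb T$ ($i\in I\cup J$), not all $-\infty$; - the Kapranov rank: the smallest rank of a lift of the matrix to the field of generalized power series in $t$ with real exponents and complex coefficients, where an entry $a\in\mathbb R$ lifts to a series of order $-a$ and $-\infty$ lifts to $0$; - the Schein/Barvinok rank: the smallest $r$ such that the matrix is a tropical product of an $n\times r$ and an $r\times n$ matrix; - the row and column ranks: the cardinality of a minimal generating set of the $\mathbb T$-semimodule generated by the rows (columns). For $A\in\mathbb T^{n\times n}$ put $$\mathrm{urk}_\star(A)=\min\{\mathrm{rk}_\star(B) : \pi(B)\in\overline{\{\pi(A^k):k\ge1\}}\},$$ and for a non-empty semigroup $S\subset\mathbb T^{n\times n}$ put $$\mathrm{urk}_\star(S)=\min\{\mathrm{rk}_\star(A) : \pi(A)\in\overline{\pi(S)}\}.$$ **Lemma.** Let $S$ be a non-empty finitely generated semigroup of matrices of $\mathbb T^{n\times n}$. Then, for any two notions of rank $\star,\ast$ in the list above, $$\mathrm{urk}_\star(S)=n\iff \forall P\in S,\ \mathrm{urk}_{\ast}(P)=n .$$ The same equivalence holds with $\mathrm{urk}_\star(S)$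 replaced by $\min\{\mathrm{urk}_\star(A) : \pi(A)\in\overline{\pi(S)}\}$. -/

import Mathlib

noncomputable section

/-- The tropical (max-plus) semiring `𝕋 = ℝ ∪ {-∞}`: the semiring addition is the maximum, with
neutral element `-∞`, and the semiring multiplication is the usual sum, with neutral element the
real number `0`. -/
def MaxPlus : Type := WithBot ℝ

namespace MaxPlus

instance : Add MaxPlus := ⟨fun a b : WithBot ℝ => max (α := WithBot ℝ) a b⟩

instance : Zero MaxPlus := ⟨(⊥ : WithBot ℝ)⟩

instance : Mul MaxPlus := ⟨fun a b : WithBot ℝ => a + b⟩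

instance : One MaxPlus := ⟨(0 : WithBot ℝ)⟩

instance : CommSemiring MaxPlus where
  add_assoc a b c := max_assoc (α := WithBot ℝ) a b c
  add_comm a b := max_comm (α := WithBot ℝ) a b
  zero_add a := max_eq_right (α := WithBot ℝ) bot_le
  add_zero a := max_eq_left (α := WithBot ℝ) bot_le
  mul_assoc a b c := add_assoc (G := WithBot ℝ) a b c
  mul_comm a b := add_comm (G := WithBot ℝ) a b
  one_mul a := zero_add (M := WithBot ℝ) a
  mul_one a := add_zero (M := WithBot ℝ) a
  zero_mul a := WithBot.bot_add (α := ℝ) a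
  mul_zero a := WithBot.add_bot (α := ℝ) a
  left_distrib a b c := (max_add_add_left (α := WithBot ℝ) a b c).symm
  right_distrib a b c := (max_add_add_right (α := WithBot ℝ) a b c).symm
  nsmul := nsmulRec

/-- The order topology of `ℝ ∪ {-∞}`. -/
instance : TopologicalSpace MaxPlus := Preorder.topology (WithBot ℝ)

/-- A real number, as an element of `𝕋`. -/
def ofReal (r : ℝ) : MaxPlus := (r : WithBot ℝ)

theorem ofReal_zero : ofReal 0 = 1 := rfl

theorem ofReal_add (r s : ℝ) : ofReal (r + s) = ofReal r * ofReal s := rfl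

/-- `n × m` matrices over `𝕋`. With the semiring structure of `𝕋`, the Mathlib product
`A * B` is `(A ⊙ B) i j = max_k (A i k + B k j)`, `c • A` is `c ⊙ A`, and `0` is the null matrix,
all of whose entries are `-∞`. -/
abbrev Mat (n m : ℕ) : Type := Matrix (Fin n) (Fin m) MaxPlus

/-! ### The projective matrix set -/

/-- Tropical equivalence: `B = r ⊙ A` for some real `r`. -/
def projSetoid (n m : ℕ) : Setoid (Mat n m) where
  r A B := ∃ r : ℝ, B = ofReal r • A
  iseqv :=
    { refl := fun A => ⟨0, by rw [ofReal_zero, one_smul]⟩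
      symm := by
        rintro A B ⟨r, rfl⟩
        exact ⟨-r, by rw [smul_smul, ← ofReal_add, neg_add_cancel, ofReal_zero, one_smul]⟩
      trans := by
        rintro A B C ⟨r, rfl⟩ ⟨s, rfl⟩
        exact ⟨s + r, by rw [smul_smul, ofReal_add]⟩ }

/-- The projective matrix set `ℙ𝕋^{n×m}`. -/
def Proj (n m : ℕ) : Type := Quotient (projSetoid n m)

/-- The quotient map `π : 𝕋^{n×m} → ℙ𝕋^{n×m}`. -/
def proj {n m : ℕ} (A : Mat n m) : Proj n m := Quotient.mk (projSetoid n m) A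

/-- The topology of `ℙ𝕋^{n×m}`: as for any projective space, it is the quotient topology on the
classes of the non-null matrices; the class of the null matrix is an isolated point.
(A set `U` is open iff `{A ≠ 0 | π A ∈ U}` is open.) -/
instance (n m : ℕ) : TopologicalSpace (Proj n m) :=
  TopologicalSpace.coinduced (fun A : {A : Mat n m // A ≠ 0} => proj A.1) inferInstance

/-! ### The notions of rank -/

/-- The tropical permanent, `max_σ (A 1 σ(1) + ⋯ + A r σ(r))`. -/
def per {r : ℕ} (A : Mat r r) : MaxPlus :=
  ∑ σ : Equiv.Perm (Fin r), ∏ i, A i (σ i)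

/-- Tropical singularity: `A` is the `1 × 1` matrix `(-∞)`, or two different permutations reach
the maximum in the permanent. -/
def Singular {r : ℕ} (A : Mat r r) : Prop :=
  (r = 1 ∧ A = 0) ∨
    ∃ σ τ : Equiv.Perm (Fin r), σ ≠ τ ∧ ∏ i, A i (σ i) = per A ∧ ∏ i, A i (τ i) = per A

/-- The permanent restricted to the even permutations. -/
def detPos {r : ℕ} (A : Mat r r) : MaxPlus :=
  ∑ σ : Equiv.Perm (Fin r) with Equiv.Perm.sign σ = 1, ∏ i, A i (σ i)

/-- The permanent restricted to the odd permutations. -/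
def detNeg {r : ℕ} (A : Mat r r) : MaxPlus :=
  ∑ σ : Equiv.Perm (Fin r) with Equiv.Perm.sign σ = -1, ∏ i, A i (σ i)

/-- Linear independence in the Gondran-Minoux sense. -/
def GMIndep {r m : ℕ} (x : Fin r → Fin m → MaxPlus) : Prop :=
  ∀ (I J : Finset (Fin r)) (α : Fin r → MaxPlus), Disjoint I J →
    (∃ i ∈ I ∪ J, α i ≠ 0) → ∑ i ∈ I, α i • x i ≠ ∑ j ∈ J, α j • x j

/-- The weak dimension of a finitely generated tropically convex set (that is, of a finitely
generated `𝕋`-submodule of `𝕋^m`): the cardinality of a generating set that is minimal for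
inclusion. All such generating sets have the same cardinality. -/
def weakDim {m : ℕ} (X : Submodule MaxPlus (Fin m → MaxPlus)) : ℕ :=
  sInf {k | ∃ G : Finset (Fin m → MaxPlus),
    Minimal (fun H : Finset (Fin m → MaxPlus) =>
      Submodule.span MaxPlus (H : Set (Fin m → MaxPlus)) = X) G ∧ G.card = k}

/-- The max-plus valuation of a generalized power series in `t` with complex coefficients and real
exponents: minus the least exponent, and `-∞` for the zero series. -/
def val (x : HahnSeries ℝ ℂ) : MaxPlus :=
  open Classical in if x = 0 then 0 else ofReal (-x.order)

/-- Tropical rank: the largest size of a non-singular square submatrix. -/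
def tropicalRank {n m : ℕ} (A : Mat n m) : ℕ :=
  sSup {r | ∃ (f : Fin r ↪ Fin n) (g : Fin r ↪ Fin m), ¬ Singular (A.submatrix f g)}

/-- Symmetrized rank: the largest size of a square submatrix `B` with `det⁺ B ≠ det⁻ B`. -/
def symmetrizedRank {n m : ℕ} (A : Mat n m) : ℕ :=
  sSup {r | ∃ (f : Fin r ↪ Fin n) (g : Fin r ↪ Fin m),
    detPos (A.submatrix f g) ≠ detNeg (A.submatrix f g)}

/-- Gondran-Minoux row rank: the largest number of independent rows. -/
def gmRowRank {n m : ℕ} (A : Mat n m) : ℕ :=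
  sSup {r | ∃ f : Fin r ↪ Fin n, GMIndep (fun i => A (f i))}

/-- Kapranov rank: the smallest rank of a lift of `A` to a matrix of power series, that is, the
smallest dimension of a tropical linear space containing the columns of `A`. -/
def kapranovRank {n m : ℕ} (A : Mat n m) : ℕ :=
  sInf {r | ∃ M : Matrix (Fin n) (Fin m) (HahnSeries ℝ ℂ), M.map val = A ∧ M.rank = r}

/-- Schein (Barvinok) rank: the smallest inner dimension of a factorization of `A`. -/
def scheinRank {n m : ℕ} (A : Mat n m) : ℕ :=
  sInf {r | ∃ (B : Mat n r) (C : Mat r m), A = B * C}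

/-- Row rank: the weak dimension of the tropical convex hull of the rows. -/
def rowRank {n m : ℕ} (A : Mat n m) : ℕ :=
  weakDim (Submodule.span MaxPlus (Set.range fun i => A i))

/-- The notions of rank of a tropical matrix. -/
inductive RankNotion
  | tropical
  | symmetrized
  | gmRow
  | gmColumn
  | kapranov
  | schein
  | row
  | column

/-- The rank of `A` for a given notion of rank. -/
def rk {n m : ℕ} : RankNotion → Mat n m → ℕ
  | .tropical, A => tropicalRank A
  | .symmetrized, A => symmetrizedRank A
  | .gmRow, A => gmRowRank A
  | .gmColumn, A => gmRowRank A.transpose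
  | .kapranov, A => kapranovRank A
  | .schein, A => scheinRank A
  | .row, A => rowRank A
  | .column, A => rowRank A.transpose

/-! ### Ultimate ranks -/

/-- The ultimate rank of a matrix `A`, computed with the notion of rank `s`: the minimal rank over
the closure of the projective semigroup `{π(A^k) | k ≥ 1}` generated by `A`. -/
def urk {n : ℕ} (s : RankNotion) (A : Mat n n) : ℕ :=
  sInf {r | ∃ B : Mat n n, proj B ∈ closure {x | ∃ k : ℕ, 1 ≤ k ∧ x = proj (A ^ k)} ∧ rk s B = r}

/-- The ultimate rank of a semigroup of matrices `S`, computed with the notion of rank `s`: the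
minimal rank over the closure of `π(S)`. -/
def semigroupUrk {n : ℕ} (s : RankNotion) (S : Subsemigroup (Mat n n)) : ℕ :=
  sInf {r | ∃ A : Mat n n, proj A ∈ closure (proj '' (S : Set (Mat n n))) ∧ rk s A = r}

/-- The second expression for the ultimate rank of a semigroup of matrices `S`: the minimal
ultimate rank over the closure of `π(S)`. -/
def semigroupMinUrk {n : ℕ} (s : RankNotion) (S : Subsemigroup (Mat n n)) : ℕ :=
  sInf {r | ∃ A : Mat n n, proj A ∈ closure (proj '' (S : Set (Mat n n))) ∧ urk s A = r}

end MaxPlus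

end

open scoped NNReal

noncomputable section

namespace MaxPlus

/-! ### Order structure of `𝕋` -/

/-! All the notions of rank are compared through two extreme situations. If some row of `A` is a
combination of the others, and likewise some column, every rank is below `n` (`rk_lt`). If `A` has a
strictly dominant permutation, meaning `A i j ≤ u i * v j` with equality exactly along `σ`, every
rank is `n` (`Dominant.rk_eq`). So it suffices to show that the hypothesis on ultimate ranks puts
every limit of `π(S)` in the second situation.

One matrix: if `urk P = n`, no limit of powers of `P` has both redundancies. Scale `P` to maximal
cycle mean one. A potential then makes the closure of the powers a compact semigroup, which contains
a nonnull idempotent `B`. An idempotent with a diagonal entry below one, or a 2-cycle of weight at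
least one, has a redundant row and column, so `B` has unit diagonal and a strict potential.
Strictness is an open condition, hence some power of `P` has a dominant permutation, and so does its
factor `P` (`Dominant.of_mul`).

The whole semigroup: `σ` is then an antihomomorphism whose image is a finite group `H`, and the
dominant entries form a cocycle. Matrices with trivial permutation have constant diagonal and a
strict potential. A single `U ∈ S` with trivial permutation dominates finitely many prescribed ones.
Transporting its potential along representatives of `H` and averaging over `H` gives one strict
potential for all generators (`exists_common_potential`). Finiteness of the generating set gives a
uniform gap `δ > 0`. The condition `IsNearPermutation e δ` is stable under products and projective
limits, so it holds on the closure of `π(S)`. Independence of the notion of rank is the case of one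
generator. -/

instance : LinearOrder MaxPlus := inferInstanceAs (LinearOrder (WithBot ℝ))

instance : OrderTopology MaxPlus := ⟨rfl⟩

theorem ofReal_ne_zero (r : ℝ) : ofReal r ≠ 0 := WithBot.coe_ne_bot (α := ℝ)

@[simp] theorem ofReal_le_ofReal {r s : ℝ} : ofReal r ≤ ofReal s ↔ r ≤ s :=
  WithBot.coe_le_coe (α := ℝ)

@[simp] theorem ofReal_lt_ofReal {r s : ℝ} : ofReal r < ofReal s ↔ r < s :=
  WithBot.coe_lt_coe (α := ℝ)

@[simp] theorem ofReal_inj {r s : ℝ} : ofReal r = ofReal s ↔ r = s :=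
  WithBot.coe_inj (α := ℝ)

theorem exists_eq_ofReal {x : MaxPlus} (hx : x ≠ 0) : ∃ r : ℝ, x = ofReal r := by
  obtain ⟨r, hr⟩ := WithBot.ne_bot_iff_exists (α := ℝ) |>.1 hx
  exact ⟨r, hr.symm⟩

theorem bot_le' (x : MaxPlus) : 0 ≤ x := bot_le (α := WithBot ℝ)

instance : Inv MaxPlus := ⟨fun x : WithBot ℝ => WithBot.map (fun r : ℝ => -r) x⟩

theorem inv_ofReal (r : ℝ) : (ofReal r)⁻¹ = ofReal (-r) := rfl

/-- Tropical inequalities become inequalities in an ordered group with zero: `0` is `-∞`, `1` is the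
real number zero, and inverses are negatives. -/
instance : LinearOrderedCommGroupWithZero MaxPlus where
  __ := (inferInstance : CommMonoidWithZero MaxPlus)
  __ := (inferInstance : LinearOrder MaxPlus)
  __ := (inferInstance : Inv MaxPlus)
  bot := 0
  bot_le := bot_le'
  isBot_zero := bot_le'
  mul_lt_mul_of_pos_left := by
    intro a ha b c hbc
    obtain ⟨a, rfl⟩ := exists_eq_ofReal ha.ne'
    obtain ⟨c, rfl⟩ := exists_eq_ofReal ((bot_le' b).trans_lt hbc).ne'
    rcases eq_or_ne b 0 with rfl | hb
    · change ofReal a * 0 < ofReal a * ofReal c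
      rw [mul_zero, ← ofReal_add]
      exact lt_of_le_of_ne (bot_le' _) (ofReal_ne_zero _).symm
    · obtain ⟨b, rfl⟩ := exists_eq_ofReal hb
      change ofReal a * ofReal b < ofReal a * ofReal c
      rw [← ofReal_add, ← ofReal_add, ofReal_lt_ofReal]
      have := ofReal_lt_ofReal.1 hbc
      linarith
  exists_pair_ne := ⟨0, 1, (ofReal_ne_zero 0).symm⟩
  inv_zero := rfl
  mul_inv_cancel := by
    intro a ha
    obtain ⟨a, rfl⟩ := exists_eq_ofReal ha
    rw [inv_ofReal, ← ofReal_add, add_neg_cancel, ofReal_zero]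

theorem add_eq_max (a b : MaxPlus) : a + b = max a b := rfl

theorem ofReal_pos (r : ℝ) : 0 < ofReal r := (ofReal_ne_zero r).pos

theorem ofReal_nsmul (k : ℕ) (r : ℝ) : ofReal (k * r) = ofReal r ^ k := by
  induction k with
  | zero => simp [ofReal_zero]
  | succ k ih => rw [pow_succ, ← ih, ← ofReal_add]; push_cast; ring_nf

/-- Every element of `𝕋` has roots of all positive orders. -/
theorem exists_pow_eq (x : MaxPlus) {b : ℕ} (hb : b ≠ 0) : ∃ y : MaxPlus, y ^ b = x := by
  rcases eq_or_ne x 0 with rfl | hx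
  · exact ⟨0, zero_pow hb⟩
  · obtain ⟨r, rfl⟩ := exists_eq_ofReal hx
    refine ⟨ofReal (r / b), ?_⟩
    rw [← ofReal_nsmul]
    congr 1
    field_simp

section Sums

variable {ι : Type*} {s : Finset ι} {f : ι → MaxPlus} {c : MaxPlus}

theorem sum_le_iff : ∑ i ∈ s, f i ≤ c ↔ ∀ i ∈ s, f i ≤ c := by
  classical
  induction s using Finset.induction_on with
  | empty => simp
  | insert a s ha ih => rw [Finset.sum_insert ha, add_eq_max, max_le_iff, ih]; simp

theorem sum_lt_iff (hc : 0 < c) : ∑ i ∈ s, f i < c ↔ ∀ i ∈ s, f i < c := by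
  classical
  induction s using Finset.induction_on with
  | empty => simpa using hc
  | insert a s ha ih => rw [Finset.sum_insert ha, add_eq_max, max_lt_iff, ih]; simp

theorem le_sum {i : ι} (hi : i ∈ s) : f i ≤ ∑ i ∈ s, f i := sum_le_iff.1 le_rfl i hi

theorem exists_eq_sum (h : ∑ i ∈ s, f i ≠ 0) : ∃ i ∈ s, ∑ i ∈ s, f i = f i := by
  by_contra! hcon
  exact lt_irrefl _ ((sum_lt_iff h.pos).2 fun i hi => lt_of_le_of_ne (le_sum hi) (hcon i hi).symm)

end Sums

section Matrices

variable {n m l : ℕ}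

theorem mul_apply_ge (A : Mat n m) (B : Mat m l) (i : Fin n) (k : Fin m) (j : Fin l) :
    A i k * B k j ≤ (A * B) i j := by
  rw [Matrix.mul_apply]
  exact le_sum (f := fun k => A i k * B k j) (Finset.mem_univ k)

theorem exists_mul_apply_eq {A : Mat n m} {B : Mat m l} {i : Fin n} {j : Fin l}
    (h : (A * B) i j ≠ 0) : ∃ k, (A * B) i j = A i k * B k j := by
  rw [Matrix.mul_apply] at h ⊢
  obtain ⟨k, -, hk⟩ := exists_eq_sum h
  exact ⟨k, hk⟩

end Matrices

/-! ### Topology of `𝕋` -/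

/-- The exponential, from `𝕋` to the nonnegative reals. -/
def expMap (x : MaxPlus) : ℝ≥0 :=
  WithBot.recBotCoe (C := fun _ => ℝ≥0) 0 (fun r : ℝ => (Real.exp r).toNNReal) x

theorem expMap_zero : expMap 0 = 0 := rfl

theorem expMap_ofReal (r : ℝ) : expMap (ofReal r) = (Real.exp r).toNNReal := rfl

theorem expMap_mul (x y : MaxPlus) : expMap (x * y) = expMap x * expMap y := by
  rcases eq_or_ne x 0 with rfl | hx
  · simp [expMap_zero]
  rcases eq_or_ne y 0 with rfl | hy
  · simp [expMap_zero]
  obtain ⟨x, rfl⟩ := exists_eq_ofReal hx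
  obtain ⟨y, rfl⟩ := exists_eq_ofReal hy
  rw [← ofReal_add, expMap_ofReal, expMap_ofReal, expMap_ofReal]
  rw [Real.exp_add, Real.toNNReal_mul (Real.exp_pos x).le]

theorem expMap_strictMono : StrictMono expMap := by
  intro x y hxy
  obtain ⟨y, rfl⟩ := exists_eq_ofReal (zero_le.trans_lt hxy).ne'
  rcases eq_or_ne x 0 with rfl | hx
  · rw [expMap_zero, expMap_ofReal, Real.toNNReal_pos]
    exact Real.exp_pos y
  · obtain ⟨x, rfl⟩ := exists_eq_ofReal hx
    rw [expMap_ofReal, expMap_ofReal, Real.toNNReal_lt_toNNReal_iff (Real.exp_pos y)]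
    exact Real.exp_lt_exp.2 (ofReal_lt_ofReal.1 hxy)

theorem expMap_surjective : Function.Surjective expMap := by
  intro y
  rcases eq_or_ne y 0 with rfl | hy
  · exact ⟨0, rfl⟩
  · refine ⟨ofReal (Real.log y), ?_⟩
    rw [expMap_ofReal, Real.exp_log (NNReal.coe_pos.2 hy.pos), Real.toNNReal_coe]

/-- The exponential is a homeomorphism from `𝕋` to the nonnegative reals. -/
def expHomeo : MaxPlus ≃ₜ ℝ≥0 :=
  (expMap_strictMono.orderIsoOfSurjective _ expMap_surjective).toHomeomorph

theorem expHomeo_apply (x : MaxPlus) : expHomeo x = expMap x := rfl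

/-- The exponential turns this product into the product of `ℝ≥0`, which settles continuity at `-∞`.
-/
instance : ContinuousMul MaxPlus where
  continuous_mul := by
    have h : (fun p : MaxPlus × MaxPlus => p.1 * p.2) =
        fun p => expHomeo.symm (expHomeo p.1 * expHomeo p.2) := by
      funext p
      rw [expHomeo_apply, expHomeo_apply, ← expMap_mul, ← expHomeo_apply,
        Homeomorph.symm_apply_apply]
    rw [h]
    fun_prop

instance : ContinuousAdd MaxPlus where
  continuous_add := continuous_max

/-- An upper bound suffices for compactness because `-∞` is a point of the space. -/
theorem isCompact_Iic (c : MaxPlus) : IsCompact (Set.Iic c) := by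
  have h : Set.Iic c = expHomeo ⁻¹' Set.Icc 0 (expHomeo c) := by
    ext x
    simp only [Set.mem_Iic, Set.mem_preimage, Set.mem_Icc, zero_le, true_and, expHomeo_apply,
      expMap_strictMono.le_iff_le]
  rw [h]
  exact expHomeo.isCompact_preimage.2 isCompact_Icc

variable {n m r : ℕ}

/-! ### Upper bounds for the ranks -/

/-- A finite generating set contains a minimal one, and `weakDim` is an infimum over those;
uniqueness of their cardinality is not needed. -/
theorem weakDim_le_card {X : Submodule MaxPlus (Fin m → MaxPlus)}
    {G : Finset (Fin m → MaxPlus)} (hG : Submodule.span MaxPlus (G : Set (Fin m → MaxPlus)) = X) :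
    weakDim X ≤ G.card := by
  obtain ⟨H, hHG, hH⟩ := exists_minimal_le_of_wellFoundedLT
    (fun H : Finset (Fin m → MaxPlus) =>
      Submodule.span MaxPlus (H : Set (Fin m → MaxPlus)) = X) G hG
  have h : weakDim X ≤ H.card := Nat.sInf_le ⟨H, hH, rfl⟩
  exact h.trans (Finset.card_le_card hHG)

theorem exists_span_eq_card_eq_rowRank (A : Mat n m) :
    ∃ G : Finset (Fin m → MaxPlus),
      Submodule.span MaxPlus (G : Set (Fin m → MaxPlus)) =
        Submodule.span MaxPlus (Set.range fun i => A i) ∧ G.card = rowRank A := by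
  classical
  obtain ⟨H, -, hH⟩ := exists_minimal_le_of_wellFoundedLT
    (fun H : Finset (Fin m → MaxPlus) => Submodule.span MaxPlus (H : Set (Fin m → MaxPlus)) =
        Submodule.span MaxPlus (Set.range fun i => A i)) (Finset.univ.image fun i => A i) (by simp)
  obtain ⟨G, hG, hc⟩ := Nat.sInf_mem (s := {k | ∃ G : Finset (Fin m → MaxPlus),
    Minimal (fun H : Finset (Fin m → MaxPlus) =>
      Submodule.span MaxPlus (H : Set (Fin m → MaxPlus)) =
        Submodule.span MaxPlus (Set.range fun i => A i)) G ∧ G.card = k}) ⟨_, H, hH, rfl⟩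
  exact ⟨G, hG.prop, hc⟩

theorem exists_eq_mul_of_mem_span {A : Mat n m} {G : Finset (Fin m → MaxPlus)}
    (h : ∀ i, A i ∈ Submodule.span MaxPlus (G : Set (Fin m → MaxPlus))) :
    ∃ (B : Mat n G.card) (C : Mat G.card m), A = B * C := by
  have h' : ∀ i, ∃ f : (Fin m → MaxPlus) → MaxPlus, ∑ a ∈ G, f a • a = A i := fun i => by
    obtain ⟨f, -, hf⟩ := Submodule.mem_span_finset.1 (h i)
    exact ⟨f, hf⟩
  choose f hf using h'
  refine ⟨Matrix.of fun i k => f i (G.equivFin.symm k),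
    Matrix.of fun k => (G.equivFin.symm k : Fin m → MaxPlus), ?_⟩
  ext i j
  rw [Matrix.mul_apply, ← hf i, Finset.sum_apply, ← Finset.sum_coe_sort,
    ← G.equivFin.symm.sum_comp]
  rfl

theorem scheinRank_le_rowRank (A : Mat n m) : scheinRank A ≤ rowRank A := by
  obtain ⟨G, hG, hc⟩ := exists_span_eq_card_eq_rowRank A
  rw [← hc]
  refine Nat.sInf_le (exists_eq_mul_of_mem_span fun i => ?_)
  rw [hG]
  exact Submodule.subset_span ⟨i, rfl⟩

theorem exists_eq_mul_scheinRank (A : Mat n m) :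
    ∃ (B : Mat n (scheinRank A)) (C : Mat (scheinRank A) m), A = B * C :=
  Nat.sInf_mem (s := {r | ∃ (B : Mat n r) (C : Mat r m), A = B * C}) ⟨n, 1, A, by simp⟩

theorem rowRank_le (A : Mat n m) : rowRank A ≤ n := by
  classical
  refine (weakDim_le_card (G := Finset.univ.image fun i => A i) (by simp)).trans ?_
  exact Finset.card_image_le.trans (by simp)

/-! ### Lifting factorizations to power series -/

/-- The series with a single coefficient, equal to `1`, and a given valuation. -/
def lift (x : MaxPlus) : HahnSeries ℝ ℂ :=
  WithBot.recBotCoe (C := fun _ => HahnSeries ℝ ℂ) 0 (fun r : ℝ => HahnSeries.single (-r) 1) x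

theorem lift_zero : lift 0 = 0 := rfl

theorem lift_ofReal (r : ℝ) : lift (ofReal r) = HahnSeries.single (-r) 1 := rfl

theorem lift_mul (x y : MaxPlus) : lift (x * y) = lift x * lift y := by
  rcases eq_or_ne x 0 with rfl | hx
  · simp [lift_zero]
  rcases eq_or_ne y 0 with rfl | hy
  · simp [lift_zero]
  obtain ⟨x, rfl⟩ := exists_eq_ofReal hx
  obtain ⟨y, rfl⟩ := exists_eq_ofReal hy
  rw [← ofReal_add, lift_ofReal, lift_ofReal, lift_ofReal, HahnSeries.single_mul_single, neg_add,
    one_mul]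

theorem coeff_lift (x : MaxPlus) (a : ℝ) :
    (lift x).coeff a = if x = ofReal (-a) then 1 else 0 := by
  rcases eq_or_ne x 0 with rfl | hx
  · rw [if_neg (ofReal_ne_zero _).symm, lift_zero, HahnSeries.coeff_zero]
  · obtain ⟨x, rfl⟩ := exists_eq_ofReal hx
    simp only [lift_ofReal, HahnSeries.coeff_single, ofReal_inj]
    exact if_congr ⟨fun h => by linarith, fun h => by linarith⟩ rfl rfl

theorem val_zero : val 0 = 0 := if_pos rfl

theorem val_of_ne {x : HahnSeries ℝ ℂ} (hx : x ≠ 0) : val x = ofReal (-x.order) := if_neg hx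

/-- Nothing cancels: each coefficient of the sum counts the terms of that exponent, and a nonzero
count is nonzero in `ℂ`. -/
theorem val_sum_lift {ι : Type*} (s : Finset ι) (f : ι → MaxPlus) :
    val (∑ i ∈ s, lift (f i)) = ∑ i ∈ s, f i := by
  rcases eq_or_ne (∑ i ∈ s, f i) 0 with h0 | h0
  · have hf : ∀ i ∈ s, f i = 0 := fun i hi => le_zero_iff.1 (sum_le_iff.1 h0.le i hi)
    rw [h0, Finset.sum_eq_zero fun i hi => by rw [hf i hi, lift_zero], val_zero]
  · obtain ⟨k, hk, hmax⟩ := exists_eq_sum h0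
    obtain ⟨c, hc⟩ := exists_eq_ofReal h0
    have hcoeff : ∀ a, (∑ i ∈ s, lift (f i)).coeff a =
        ((s.filter fun i => f i = ofReal (-a)).card : ℂ) := fun a => by
      rw [HahnSeries.coeff_sum]
      simp_rw [coeff_lift]
      rw [Finset.sum_boole]
    have hlead : (∑ i ∈ s, lift (f i)).coeff (-c) ≠ 0 := by
      rw [hcoeff, Nat.cast_ne_zero, Finset.card_ne_zero]
      exact ⟨k, Finset.mem_filter.2 ⟨hk, by rw [← hmax, hc, neg_neg]⟩⟩
    have hne : ∑ i ∈ s, lift (f i) ≠ 0 := fun h => hlead (by rw [h, HahnSeries.coeff_zero])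
    rw [val_of_ne hne, hc, ofReal_inj]
    have h1 := HahnSeries.order_le_of_coeff_ne_zero hlead
    have h2 := HahnSeries.coeff_order_eq_zero.not.2 hne
    rw [hcoeff, ← ne_eq, Nat.cast_ne_zero, Finset.card_ne_zero] at h2
    obtain ⟨i, hi⟩ := h2
    obtain ⟨his, hi⟩ := Finset.mem_filter.1 hi
    have h3 : f i ≤ ofReal c := hc ▸ le_sum his
    rw [hi, ofReal_le_ofReal] at h3
    linarith

theorem exists_lift_mul (B : Mat n r) (C : Mat r m) :
    ∃ M : Matrix (Fin n) (Fin m) (HahnSeries ℝ ℂ), M.map val = B * C ∧ M.rank ≤ r := by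
  refine ⟨B.map lift * C.map lift, ?_, ?_⟩
  · ext i j
    simp only [Matrix.map_apply, Matrix.mul_apply, ← lift_mul, val_sum_lift]
  · refine (Matrix.rank_mul_le_left _ _).trans ?_
    simpa using Matrix.rank_le_card_width (B.map lift)

theorem kapranovRank_le_scheinRank (A : Mat n m) : kapranovRank A ≤ scheinRank A := by
  obtain ⟨B, C, h⟩ := exists_eq_mul_scheinRank A
  obtain ⟨M, hM, hr⟩ := exists_lift_mul B C
  have h' : kapranovRank A ≤ M.rank := Nat.sInf_le ⟨M, hM.trans h.symm, rfl⟩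
  exact h'.trans hr

theorem sSup_le_of_forall_le {T : Set ℕ} {k : ℕ} (h : ∀ r ∈ T, r ≤ k) : sSup T ≤ k := by
  rcases T.eq_empty_or_nonempty with rfl | hT
  · simp
  · exact csSup_le hT h

theorem le_of_embedding (f : Fin r ↪ Fin n) : r ≤ n := by
  simpa using Fintype.card_le_of_embedding f

theorem rk_le (t : RankNotion) (A : Mat n n) : rk t A ≤ n := by
  cases t with
  | tropical => exact sSup_le_of_forall_le fun r ⟨f, _⟩ => le_of_embedding f
  | symmetrized => exact sSup_le_of_forall_le fun r ⟨f, _⟩ => le_of_embedding f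
  | gmRow => exact sSup_le_of_forall_le fun r ⟨f, _⟩ => le_of_embedding f
  | gmColumn => exact sSup_le_of_forall_le fun r ⟨f, _⟩ => le_of_embedding f
  | kapranov =>
    exact (kapranovRank_le_scheinRank A).trans ((scheinRank_le_rowRank A).trans (rowRank_le A))
  | schein => exact (scheinRank_le_rowRank A).trans (rowRank_le A)
  | row => exact rowRank_le A
  | column => exact rowRank_le A.transpose

/-! ### Matrices with a redundant row and a redundant column -/

/-- Some row of `A` is a combination of the other rows. -/
def HasRedundantRow (A : Mat n m) : Prop :=
  ∃ (i : Fin n) (c : Fin n → MaxPlus), A i = ∑ j ∈ Finset.univ.erase i, c j • A j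

theorem HasRedundantRow.rowRank_lt {A : Mat n m} (h : HasRedundantRow A) : rowRank A < n := by
  classical
  obtain ⟨i, c, hi⟩ := h
  have hn : 0 < n := i.pos
  refine (weakDim_le_card (G := (Finset.univ.erase i).image fun j => A j) ?_).trans_lt ?_
  · apply le_antisymm
    · apply Submodule.span_mono
      intro x hx
      simp only [Finset.coe_image, Set.mem_image] at hx
      obtain ⟨j, -, rfl⟩ := hx
      exact ⟨j, rfl⟩
    · rw [Submodule.span_le]
      have key : ∀ j ∈ Finset.univ.erase i, A j ∈ Submodule.span MaxPlus
          (((Finset.univ.erase i).image fun j => A j : Finset (Fin m → MaxPlus)) :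
            Set (Fin m → MaxPlus)) := fun j hj =>
        Submodule.subset_span (Finset.mem_coe.2 (Finset.mem_image_of_mem _ hj))
      rintro _ ⟨j, rfl⟩
      rcases eq_or_ne j i with rfl | hj
      · change A j ∈ _
        rw [hi]
        exact Submodule.sum_mem _ fun k hk => Submodule.smul_mem _ _ (key k hk)
      · exact key j (Finset.mem_erase.2 ⟨hj, Finset.mem_univ _⟩)
  · refine Finset.card_image_le.trans_lt ?_
    rw [Finset.card_erase_of_mem (Finset.mem_univ _), Finset.card_univ, Fintype.card_fin]
    omega

theorem HasRedundantRow.gmRowRank_lt {A : Mat n m} (h : HasRedundantRow A) : gmRowRank A < n := by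
  classical
  obtain ⟨i, c, hi⟩ := h
  have hn : 0 < n := i.pos
  have : ∀ r ∈ {r | ∃ f : Fin r ↪ Fin n, GMIndep (fun i => A (f i))}, r ≤ n - 1 := by
    rintro r ⟨f, hf⟩
    by_contra hr
    obtain rfl : r = n := le_antisymm (le_of_embedding f) (by omega)
    have hbij : Function.Bijective f := Finite.injective_iff_bijective.1 f.injective
    let e := Equiv.ofBijective f hbij
    have hfe : ∀ k, f k = e k := fun k => rfl
    -- A family of `n` rows is a reindexing of all rows, so the redundancy is a Gondran–Minoux
    -- relation with one row on the left.
    refine hf {e.symm i} (Finset.univ.erase (e.symm i)) (fun k => if e k = i then 1 else c (e k))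
      (by simp) ⟨e.symm i, by simp⟩ ?_
    simp only [hfe, Finset.sum_singleton, Equiv.apply_symm_apply, if_true, one_smul]
    rw [hi]
    refine Finset.sum_bij (fun k _ => e.symm k) ?_ ?_ ?_ ?_
    · intro k hk; simpa using hk
    · intro k _ l _ hkl; simpa using hkl
    · intro k hk; exact ⟨e k, by simpa [Equiv.eq_symm_apply] using hk, by simp⟩
    · intro k hk
      have : k ≠ i := by simpa using hk
      simp [this]
  exact (sSup_le_of_forall_le this).trans_lt (by omega)

/-- For a product through fewer than `n` indices, every permutation of nonzero weight can be
modified by a transposition without decreasing its weight. -/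
theorem exists_swap_le {B : Mat n r} {C : Mat r n} (hr : r < n) {σ : Equiv.Perm (Fin n)}
    (hσ : ∏ i, (B * C) i (σ i) ≠ 0) :
    ∃ i i' : Fin n, i ≠ i' ∧
      ∏ l, (B * C) l (σ l) ≤ ∏ l, (B * C) l ((σ * Equiv.swap i i') l) := by
  have h : ∀ l, ∃ k, (B * C) l (σ l) = B l k * C k (σ l) := fun l =>
    exists_mul_apply_eq (Finset.prod_ne_zero_iff.1 hσ l (Finset.mem_univ l))
  choose k hk using h
  -- Two rows pass through the same inner index; exchanging their exits reuses the same entries of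
  -- `B` and `C`.
  obtain ⟨i, i', hne, hii'⟩ := Fintype.exists_ne_map_eq_of_card_lt k (by simpa using hr)
  have hks : ∀ l, k (Equiv.swap i i' l) = k l := fun l => by
    rcases eq_or_ne l i with rfl | h1
    · rw [Equiv.swap_apply_left, hii']
    rcases eq_or_ne l i' with rfl | h2
    · rw [Equiv.swap_apply_right, hii']
    · rw [Equiv.swap_apply_of_ne_of_ne h1 h2]
  refine ⟨i, i', hne, ?_⟩
  calc ∏ l, (B * C) l (σ l) = (∏ l, B l (k l)) * ∏ l, C (k l) (σ l) := by
        rw [← Finset.prod_mul_distrib]; exact Finset.prod_congr rfl fun l _ => hk l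
    _ = (∏ l, B l (k l)) * ∏ l, C (k (Equiv.swap i i' l)) (σ (Equiv.swap i i' l)) := by
        rw [Equiv.prod_comp (Equiv.swap i i') (fun l => C (k l) (σ l))]
    _ = ∏ l, B l (k l) * C (k l) ((σ * Equiv.swap i i') l) := by
        rw [← Finset.prod_mul_distrib]; exact Finset.prod_congr rfl fun l _ => by rw [hks]; rfl
    _ ≤ ∏ l, (B * C) l ((σ * Equiv.swap i i') l) :=
        Finset.prod_le_prod' fun l _ => mul_apply_ge _ _ _ _ _

theorem le_per (A : Mat n n) (σ : Equiv.Perm (Fin n)) : ∏ i, A i (σ i) ≤ per A :=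
  le_sum (f := fun σ : Equiv.Perm (Fin n) => ∏ i, A i (σ i)) (Finset.mem_univ σ)

theorem singular_mul (B : Mat n r) (C : Mat r n) (hr : r < n) : Singular (B * C) := by
  rcases eq_or_ne (per (B * C)) 0 with h0 | h0
  -- With permanent `-∞` all permutations tie, so two distinct ones suffice; size one falls under
  -- the separate clause of `Singular`.
  · have hall : ∀ σ : Equiv.Perm (Fin n), ∏ i, (B * C) i (σ i) = 0 := fun σ =>
      le_zero_iff.1 (h0 ▸ le_per _ σ)
    rcases Nat.lt_or_ge 1 n with hn | hn
    · right
      refine ⟨1, Equiv.swap ⟨0, by omega⟩ ⟨1, hn⟩, ?_, by rw [hall, h0], by rw [hall, h0]⟩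
      intro h
      rw [eq_comm, Equiv.swap_eq_one_iff] at h
      simp at h
    · left
      obtain rfl : n = 1 := by omega
      refine ⟨rfl, ?_⟩
      ext i j
      have := hall 1
      rw [Fin.prod_univ_one] at this
      rw [Subsingleton.elim i 0, Subsingleton.elim j 0]
      exact this
  · right
    obtain ⟨σ, -, hσ⟩ := exists_eq_sum h0
    obtain ⟨i, i', hne, hle⟩ := exists_swap_le (B := B) (C := C) hr (σ := σ) (by
      rw [← hσ]; exact h0)
    refine ⟨σ, σ * Equiv.swap i i', ?_, hσ.symm, le_antisymm (le_per _ _) (hσ.le.trans hle)⟩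
    intro h
    rw [left_eq_mul, Equiv.swap_eq_one_iff] at h
    exact hne h

/-- The transposition of `exists_swap_le` changes the sign, so each parity bounds the other. -/
theorem detPos_mul_eq_detNeg (B : Mat n r) (C : Mat r n) (hr : r < n) :
    detPos (B * C) = detNeg (B * C) := by
  have key : ∀ (a b : ℤˣ), a = -b → ∑ σ : Equiv.Perm (Fin n) with Equiv.Perm.sign σ = a,
      ∏ i, (B * C) i (σ i) ≤ ∑ σ : Equiv.Perm (Fin n) with Equiv.Perm.sign σ = b,
      ∏ i, (B * C) i (σ i) := by
    intro a b hab
    rw [sum_le_iff]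
    intro σ hσ
    rcases eq_or_ne (∏ i, (B * C) i (σ i)) 0 with h0 | h0
    · rw [h0]; exact zero_le
    · obtain ⟨i, i', hne, hle⟩ := exists_swap_le hr h0
      refine hle.trans (le_sum (f := fun σ : Equiv.Perm (Fin n) => ∏ i, (B * C) i (σ i)) ?_)
      simp only [Finset.mem_filter, Finset.mem_univ, true_and] at hσ ⊢
      rw [Equiv.Perm.sign_mul, Equiv.Perm.sign_swap hne, hσ, hab]
      simp
  exact le_antisymm (key 1 (-1) (by simp)) (key (-1) 1 rfl)

theorem tropicalRank_lt {A : Mat n n} (h : scheinRank A < n) : tropicalRank A < n := by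
  obtain ⟨B, C, hA⟩ := exists_eq_mul_scheinRank A
  refine (sSup_le_of_forall_le (k := n - 1) ?_).trans_lt (by omega)
  rintro r ⟨f, g, hfg⟩
  by_contra hr
  obtain rfl : r = n := le_antisymm (le_of_embedding f) (by omega)
  refine hfg ?_
  rw [hA, Matrix.submatrix_mul _ _ f id g Function.bijective_id]
  exact singular_mul _ _ h

theorem symmetrizedRank_lt {A : Mat n n} (h : scheinRank A < n) : symmetrizedRank A < n := by
  obtain ⟨B, C, hA⟩ := exists_eq_mul_scheinRank A
  refine (sSup_le_of_forall_le (k := n - 1) ?_).trans_lt (by omega)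
  rintro r ⟨f, g, hfg⟩
  by_contra hr
  obtain rfl : r = n := le_antisymm (le_of_embedding f) (by omega)
  refine hfg ?_
  rw [hA, Matrix.submatrix_mul _ _ f id g Function.bijective_id]
  exact detPos_mul_eq_detNeg _ _ h

/-- A redundant row lowers the Schein rank, which controls the Kapranov, tropical and symmetrized
ranks. The redundant column serves only the two column notions. -/
theorem rk_lt (t : RankNotion) {A : Mat n n} (h : HasRedundantRow A)
    (h' : HasRedundantRow A.transpose) : rk t A < n := by
  have hs : scheinRank A < n := (scheinRank_le_rowRank A).trans_lt h.rowRank_lt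
  cases t with
  | tropical => exact tropicalRank_lt hs
  | symmetrized => exact symmetrizedRank_lt hs
  | gmRow => exact h.gmRowRank_lt
  | gmColumn => exact h'.gmRowRank_lt
  | kapranov => exact (kapranovRank_le_scheinRank A).trans_lt hs
  | schein => exact hs
  | row => exact h.rowRank_lt
  | column => exact h'.rowRank_lt

/-! ### Strictly dominant permutations -/

/-- The entries of `A` are bounded by `u i * v j`, with equality exactly along the permutation
`σ`. -/
structure Dominant (σ : Equiv.Perm (Fin n)) (u v : Fin n → MaxPlus) (A : Mat n n) : Prop where
  left_ne : ∀ i, u i ≠ 0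
  right_ne : ∀ j, v j ≠ 0
  apply_eq : ∀ i, A i (σ i) = u i * v (σ i)
  apply_lt : ∀ i j, j ≠ σ i → A i j < u i * v j

namespace Dominant

variable {σ τ : Equiv.Perm (Fin n)} {u v : Fin n → MaxPlus} {A : Mat n n}

theorem apply_le (h : Dominant σ u v A) (i j : Fin n) : A i j ≤ u i * v j := by
  rcases eq_or_ne j (σ i) with rfl | hj
  · exact (h.apply_eq i).le
  · exact (h.apply_lt i j hj).le

theorem apply_ne_zero (h : Dominant σ u v A) (i : Fin n) : A i (σ i) ≠ 0 := by
  rw [h.apply_eq]; exact mul_ne_zero (h.left_ne _) (h.right_ne _)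

theorem apply_inv_eq (h : Dominant σ u v A) (j : Fin n) : A (σ⁻¹ j) j = u (σ⁻¹ j) * v j := by
  simpa using h.apply_eq (σ⁻¹ j)

protected theorem transpose (h : Dominant σ u v A) : Dominant σ⁻¹ v u A.transpose where
  left_ne := h.right_ne
  right_ne := h.left_ne
  apply_eq j := by rw [Matrix.transpose_apply, h.apply_inv_eq, mul_comm]
  apply_lt j i hij := by
    rw [Matrix.transpose_apply, mul_comm]
    exact h.apply_lt i j fun h => hij (by rw [h]; simp)

/-- The bounds `u i * v (τ i)` have the same product for every `τ`; only `σ` attains all of them. -/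
theorem prod_lt (h : Dominant σ u v A) (hτ : τ ≠ σ) : ∏ i, A i (τ i) < ∏ i, A i (σ i) := by
  have hσ : ∏ i, A i (σ i) = (∏ i, u i) * ∏ i, v i := by
    rw [← Equiv.prod_comp σ v, ← Finset.prod_mul_distrib]
    exact Finset.prod_congr rfl fun i _ => h.apply_eq i
  have hτ' : ∏ i, u i * v (τ i) = (∏ i, u i) * ∏ i, v i := by
    rw [Finset.prod_mul_distrib, Equiv.prod_comp τ v]
  have hne : (∏ i, u i) * ∏ i, v i ≠ 0 := mul_ne_zero
    (Finset.prod_ne_zero_iff.2 fun i _ => h.left_ne i)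
    (Finset.prod_ne_zero_iff.2 fun i _ => h.right_ne i)
  obtain ⟨i, hi⟩ : ∃ i, τ i ≠ σ i := by
    by_contra! hcon
    exact hτ (Equiv.ext hcon)
  rw [hσ, ← hτ']
  -- Strict monotonicity of products needs positive factors, so a factor `-∞` is treated apart.
  by_cases h0 : ∃ k, A k (τ k) = 0
  · obtain ⟨k, hk⟩ := h0
    rw [Finset.prod_eq_zero (Finset.mem_univ k) hk, hτ']
    exact hne.pos
  · push Not at h0
    exact Finset.prod_lt_prod (fun k _ => (h0 k).pos) (fun k _ => h.apply_le k (τ k))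
      ⟨i, Finset.mem_univ i, h.apply_lt i (τ i) hi⟩

theorem unique {u' v' : Fin n → MaxPlus} (h : Dominant σ u v A) (h' : Dominant τ u' v' A) :
    σ = τ := by
  by_contra hne
  exact lt_asymm (h.prod_lt (Ne.symm hne)) (h'.prod_lt hne)

theorem not_singular (h : Dominant σ u v A) : ¬ Singular A := by
  rintro (⟨rfl, rfl⟩ | ⟨τ, τ', hne, hτ, hτ'⟩)
  · exact h.apply_ne_zero 0 rfl
  · have key : ∀ ρ : Equiv.Perm (Fin n), ∏ i, A i (ρ i) = per A → ρ = σ := fun ρ hρ => by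
      by_contra hρσ
      exact (h.prod_lt hρσ).not_ge (hρ ▸ le_per A σ)
    exact hne ((key τ hτ).trans (key τ' hτ').symm)

theorem detPos_ne_detNeg (h : Dominant σ u v A) : detPos A ≠ detNeg A := by
  have hpos : 0 < ∏ i, A i (σ i) :=
    (Finset.prod_ne_zero_iff.2 fun i _ => h.apply_ne_zero i).pos
  have key : ∀ a b : ℤˣ, a ≠ b → Equiv.Perm.sign σ = a →
      ∑ τ : Equiv.Perm (Fin n) with Equiv.Perm.sign τ = b, ∏ i, A i (τ i) <
      ∑ τ : Equiv.Perm (Fin n) with Equiv.Perm.sign τ = a, ∏ i, A i (τ i) := by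
    intro a b hab hσ
    refine lt_of_lt_of_le ((sum_lt_iff hpos).2 fun τ hτ => h.prod_lt ?_)
      (le_sum (f := fun τ : Equiv.Perm (Fin n) => ∏ i, A i (τ i)) (i := σ) (by simpa using hσ))
    rintro rfl
    exact hab (hσ.symm.trans (by simpa using hτ))
  rcases Int.units_eq_one_or (Equiv.Perm.sign σ) with hs | hs
  · exact (key 1 (-1) (by decide) hs).ne'
  · exact (key (-1) 1 (by decide) hs).ne

theorem gmIndep (h : Dominant σ u v A) : GMIndep (fun i => A i) := by
  intro I J α hIJ hα heq
  -- For `i` maximizing `α i * u i`, the `i`-th term strictly dominates column `σ i`, so the two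
  -- sides differ there.
  obtain ⟨i, hi, hmax⟩ := Finset.exists_max_image (I ∪ J) (fun i => α i * u i)
    (hα.imp fun i hi => hi.1)
  have hαi : 0 < α i * u i := by
    obtain ⟨k, hk, hk0⟩ := hα
    exact (mul_ne_zero hk0 (h.left_ne k)).pos.trans_le (hmax k hk)
  have hcol := congrFun heq (σ i)
  simp only [Finset.sum_apply, Pi.smul_apply, smul_eq_mul] at hcol
  have hval : α i * A i (σ i) = α i * u i * v (σ i) := by rw [h.apply_eq, mul_assoc]
  have hpos : 0 < α i * A i (σ i) := by
    rw [hval]; exact mul_pos hαi (h.right_ne _).pos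
  have hlt : ∀ k ∈ I ∪ J, k ≠ i → α k * A k (σ i) < α i * A i (σ i) := by
    intro k hk hki
    rcases eq_or_ne (α k) 0 with h0 | h0
    · rw [h0, zero_mul]; exact hpos
    · calc α k * A k (σ i) < α k * (u k * v (σ i)) :=
            mul_lt_mul_of_pos_left (h.apply_lt k _ fun h => hki (σ.injective h).symm) h0.pos
        _ = α k * u k * v (σ i) := (mul_assoc _ _ _).symm
        _ ≤ α i * u i * v (σ i) := mul_le_mul_left (hmax k hk) _
        _ = α i * A i (σ i) := hval.symm
  have key : ∀ I' J' : Finset (Fin n), Disjoint I' J' → I' ∪ J' = I ∪ J → i ∈ I' →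
      ∑ k ∈ J', α k * A k (σ i) < ∑ k ∈ I', α k * A k (σ i) := by
    intro I' J' hd hu hi'
    refine lt_of_lt_of_le ((sum_lt_iff hpos).2 fun k hk => hlt k ?_ ?_)
      (le_sum (f := fun k => α k * A k (σ i)) hi')
    · rw [← hu]; exact Finset.mem_union_right _ hk
    · rintro rfl; exact Finset.disjoint_left.1 hd hi' hk
  rcases Finset.mem_union.1 hi with hI | hJ
  · exact (key I J hIJ rfl hI).ne' hcol
  · exact (key J I hIJ.symm (Finset.union_comm _ _) hJ).ne hcol

/-- Through fewer than `n` inner indices, `exists_swap_le` would produce a second permutation of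
maximal weight. -/
theorem le_of_eq_mul (h : Dominant σ u v A) {B : Mat n r} {C : Mat r n} (hA : A = B * C) :
    n ≤ r := by
  by_contra! hr
  have hne : ∏ i, (B * C) i (σ i) ≠ 0 := by
    rw [← hA]; exact Finset.prod_ne_zero_iff.2 fun i _ => h.apply_ne_zero i
  obtain ⟨i, i', hii', hle⟩ := exists_swap_le hr hne
  rw [← hA] at hle
  refine (h.prod_lt ?_).not_ge hle
  intro h
  rw [mul_eq_left, Equiv.swap_eq_one_iff] at h
  exact hii' h

theorem scheinRank_eq (h : Dominant σ u v A) : n ≤ scheinRank A := by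
  obtain ⟨B, C, hA⟩ := exists_eq_mul_scheinRank A
  exact h.le_of_eq_mul hA

end Dominant

/-! ### Valuations and the Kapranov rank of a dominant matrix -/

theorem val_mul (x y : HahnSeries ℝ ℂ) : val (x * y) = val x * val y := by
  rcases eq_or_ne x 0 with rfl | hx
  · simp [val_zero]
  rcases eq_or_ne y 0 with rfl | hy
  · simp [val_zero]
  rw [val_of_ne hx, val_of_ne hy, val_of_ne (mul_ne_zero hx hy), HahnSeries.order_mul hx hy,
    neg_add, ofReal_add]

theorem val_ne_zero {x : HahnSeries ℝ ℂ} (hx : x ≠ 0) : val x ≠ 0 := by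
  rw [val_of_ne hx]; exact ofReal_ne_zero _

theorem val_neg (x : HahnSeries ℝ ℂ) : val (-x) = val x := by
  rcases eq_or_ne x 0 with rfl | hx
  · simp
  · rw [val_of_ne hx, val_of_ne (neg_ne_zero.2 hx), HahnSeries.order_neg]

theorem val_add_le (x y : HahnSeries ℝ ℂ) : val (x + y) ≤ val x + val y := by
  rcases eq_or_ne x 0 with rfl | hx
  · simp [val_zero]
  rcases eq_or_ne y 0 with rfl | hy
  · simp [val_zero]
  rcases eq_or_ne (x + y) 0 with hxy | hxy
  · rw [hxy, val_zero]; exact zero_le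
  rw [val_of_ne hx, val_of_ne hy, val_of_ne hxy, add_eq_max, le_max_iff, ofReal_le_ofReal,
    ofReal_le_ofReal, neg_le_neg_iff, neg_le_neg_iff]
  exact min_le_iff.1 (HahnSeries.min_order_le_order_add hxy)

theorem val_sum_le {ι : Type*} (s : Finset ι) (f : ι → HahnSeries ℝ ℂ) :
    val (∑ i ∈ s, f i) ≤ ∑ i ∈ s, val (f i) := by
  classical
  induction s using Finset.induction_on with
  | empty => simp [val_zero]
  | insert a s ha ih =>
    rw [Finset.sum_insert ha, Finset.sum_insert ha]
    refine (val_add_le _ _).trans ?_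
    rw [add_eq_max, add_eq_max]
    exact max_le_max le_rfl ih

namespace Dominant

variable {σ τ : Equiv.Perm (Fin n)} {u v : Fin n → MaxPlus} {A : Mat n n}

theorem rank_eq (h : Dominant σ u v A) {M : Matrix (Fin n) (Fin n) (HahnSeries ℝ ℂ)}
    (hM : M.map val = A) : M.rank = n := by
  have hMA : ∀ i j, val (M i j) = A i j := fun i j => by rw [← hM]; rfl
  suffices hdet : M.det ≠ 0 by
    simpa using Matrix.rank_of_isUnit M ((Matrix.isUnit_iff_isUnit_det M).2 hdet.isUnit)
  intro hdet
  obtain ⟨x, hx, hMx⟩ := Matrix.exists_mulVec_eq_zero_iff.2 hdet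
  obtain ⟨k, hk⟩ := Function.ne_iff.1 hx
  -- For a kernel vector `x` and `j` maximizing `v j * val (x j)`, the `j`-th term of row `σ⁻¹ j`
  -- has strictly the largest valuation and cannot be cancelled.
  obtain ⟨j, -, hmax⟩ := Finset.exists_max_image Finset.univ (fun j => v j * val (x j))
    ⟨k, Finset.mem_univ k⟩
  have hj : 0 < v j * val (x j) :=
    (mul_ne_zero (h.right_ne k) (val_ne_zero hk)).pos.trans_le (hmax k (Finset.mem_univ k))
  set i := σ⁻¹ j with hi
  have hrow := congrFun hMx i
  rw [Matrix.mulVec, dotProduct, ← Finset.add_sum_erase _ _ (Finset.mem_univ j), Pi.zero_apply,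
    add_eq_zero_iff_eq_neg] at hrow
  have hval := congrArg val hrow
  rw [val_neg, val_mul, hMA, hi, h.apply_inv_eq, mul_assoc] at hval
  have hpos : 0 < u (σ⁻¹ j) * (v j * val (x j)) := mul_pos (h.left_ne _).pos hj
  refine lt_irrefl _ (hval.le.trans_lt ((val_sum_le _ _).trans_lt ((sum_lt_iff hpos).2 ?_)))
  intro l hl
  rw [val_mul, hMA]
  have hlj : l ≠ σ (σ⁻¹ j) := by simpa using hl
  rcases eq_or_ne (val (x l)) 0 with h0 | h0
  · rw [h0, mul_zero]; exact hpos
  · calc A (σ⁻¹ j) l * val (x l) < u (σ⁻¹ j) * v l * val (x l) :=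
          mul_lt_mul_of_pos_right (h.apply_lt _ _ hlj) h0.pos
      _ = u (σ⁻¹ j) * (v l * val (x l)) := mul_assoc _ _ _
      _ ≤ _ := mul_le_mul_right (hmax l (Finset.mem_univ l)) _

theorem kapranovRank_eq (h : Dominant σ u v A) : kapranovRank A = n := by
  obtain ⟨M, hM, -⟩ := exists_lift_mul A (1 : Mat n n)
  rw [mul_one] at hM
  obtain ⟨M, hM, hr⟩ := Nat.sInf_mem (s := {r | ∃ M : Matrix (Fin n) (Fin n) (HahnSeries ℝ ℂ),
    M.map val = A ∧ M.rank = r}) ⟨_, M, hM, rfl⟩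
  exact hr.symm.trans (h.rank_eq hM)

theorem gmRowRank_ge (h : Dominant σ u v A) : n ≤ gmRowRank A :=
  le_csSup ⟨n, fun _ ⟨f, _⟩ => le_of_embedding f⟩ ⟨Function.Embedding.refl _, h.gmIndep⟩

theorem rk_eq (t : RankNotion) (h : Dominant σ u v A) : rk t A = n := by
  refine le_antisymm (rk_le t A) ?_
  cases t with
  | tropical =>
    exact le_csSup ⟨n, fun _ ⟨f, _⟩ => le_of_embedding f⟩
      ⟨Function.Embedding.refl _, Function.Embedding.refl _, h.not_singular⟩
  | symmetrized =>
    exact le_csSup ⟨n, fun _ ⟨f, _⟩ => le_of_embedding f⟩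
      ⟨Function.Embedding.refl _, Function.Embedding.refl _, h.detPos_ne_detNeg⟩
  | gmRow => exact h.gmRowRank_ge
  | gmColumn => exact h.transpose.gmRowRank_ge
  | kapranov => exact h.kapranovRank_eq.ge
  | schein => exact h.scheinRank_eq
  | row => exact h.scheinRank_eq.trans (scheinRank_le_rowRank A)
  | column => exact h.transpose.scheinRank_eq.trans (scheinRank_le_rowRank _)

/-- If a product has a dominant permutation, then so do its factors, and the dominant entries
multiply. -/
theorem of_mul {A B : Mat n n} (h : Dominant σ u v (A * B)) :
    ∃ (κ : Equiv.Perm (Fin n)) (w : Fin n → MaxPlus), Dominant κ u w A ∧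
      Dominant (σ * κ⁻¹) (fun k => (w k)⁻¹) v B ∧
      ∀ i, (A * B) i (σ i) = A i (κ i) * B (κ i) (σ i) := by
  have hk : ∀ i, ∃ k, (A * B) i (σ i) = A i k * B k (σ i) := fun i =>
    exists_mul_apply_eq (h.apply_ne_zero i)
  choose k hk using hk
  have hne : ∀ i, A i (k i) * B (k i) (σ i) ≠ 0 := fun i => hk i ▸ h.apply_ne_zero i
  have hAne : ∀ i, A i (k i) ≠ 0 := fun i => left_ne_zero_of_mul (hne i)
  -- If two rows shared an inner index, exchanging their exits would give two non-dominant entries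
  -- of `A * B` whose product is at least that of the dominant ones.
  have hinj : Function.Injective k := by
    intro i i' hii'
    by_contra hcon
    have h1 := (mul_apply_ge A B i (k i) (σ i')).trans_lt
      (h.apply_lt i (σ i') fun h => hcon (σ.injective h).symm)
    have h2 := (mul_apply_ge A B i' (k i') (σ i)).trans_lt
      (h.apply_lt i' (σ i) fun h => hcon (σ.injective h))
    have h3 := mul_lt_mul'' h1 h2 zero_le zero_le
    have h4 : u i * v (σ i') * (u i' * v (σ i)) = (u i * v (σ i)) * (u i' * v (σ i')) := by ring
    have h5 : A i (k i) * B (k i) (σ i') * (A i' (k i') * B (k i') (σ i)) =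
        (A i (k i) * B (k i) (σ i)) * (A i' (k i') * B (k i') (σ i')) := by
      rw [hii']; ring
    rw [h4, h5, ← hk, ← hk, ← h.apply_eq, ← h.apply_eq] at h3
    exact lt_irrefl _ h3
  let κ : Equiv.Perm (Fin n) := Equiv.ofBijective k (Finite.injective_iff_bijective.1 hinj)
  have hκ : ∀ i, κ i = k i := fun i => rfl
  have hκinv : ∀ i, κ⁻¹ (κ i) = i := κ.symm_apply_apply
  have hl : ∀ l, ∃ i, l = κ i := fun l => ⟨κ⁻¹ l, by simp⟩
  -- The only choice of `w` making the bound for `A` tight along `κ`.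
  let w : Fin n → MaxPlus := fun l => (u (κ⁻¹ l))⁻¹ * A (κ⁻¹ l) l
  have hw : ∀ i, w (κ i) = (u i)⁻¹ * A i (k i) := fun i => by simp only [w, hκinv]; rfl
  have hwne : ∀ l, w l ≠ 0 := fun l => by
    obtain ⟨i, rfl⟩ := hl l
    rw [hw]; exact mul_ne_zero (inv_ne_zero (h.left_ne i)) (hAne i)
  have hAw : ∀ i, A i (k i) = u i * w (κ i) := fun i => by
    rw [hw, mul_inv_cancel_left₀ (h.left_ne i)]
  have hB : ∀ i, w (κ i) * B (κ i) (σ i) = v (σ i) := fun i => by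
    have h1 := h.apply_eq i
    rw [hk, hAw, mul_assoc] at h1
    exact mul_left_cancel₀ (h.left_ne i) h1
  refine ⟨κ, w, ⟨h.left_ne, hwne, hAw, ?_⟩, ⟨fun l => inv_ne_zero (hwne l), h.right_ne, ?_, ?_⟩, hk⟩
  · intro i l hli
    obtain ⟨i', rfl⟩ := hl l
    have h1 := (mul_apply_ge A B i (κ i') (σ i')).trans_lt
      (h.apply_lt i (σ i') fun h => hli (by rw [σ.injective h]))
    rw [← hB i', ← mul_assoc] at h1
    exact lt_of_mul_lt_mul_right h1 zero_le
  · intro l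
    obtain ⟨i, rfl⟩ := hl l
    simp only [Equiv.Perm.mul_apply, hκinv]
    rw [← hB i, inv_mul_cancel_left₀ (hwne _)]
  · intro l j hj
    obtain ⟨i, rfl⟩ := hl l
    simp only [Equiv.Perm.mul_apply, hκinv] at hj
    have h1 := (mul_apply_ge A B i (κ i) j).trans_lt (h.apply_lt i j hj)
    rw [hκ, hAw, mul_assoc] at h1
    rw [← hκ] at h1
    have h2 := lt_of_mul_lt_mul_left h1 zero_le
    rw [← inv_mul_cancel_left₀ (hwne (κ i)) (B (κ i) j)]
    exact mul_lt_mul_of_pos_left h2 (inv_ne_zero (hwne _)).pos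

end Dominant

/-! ### Walks and potentials -/

theorem exists_walk (P : Mat n n) (k : ℕ) (i j : Fin n) (h : (P ^ k) i j ≠ 0) :
    ∃ p : ℕ → Fin n, p 0 = i ∧ p k = j ∧
      (P ^ k) i j = ∏ l ∈ Finset.range k, P (p l) (p (l + 1)) := by
  induction k generalizing i with
  | zero =>
    rcases eq_or_ne i j with rfl | hij
    · exact ⟨fun _ => i, rfl, rfl, by simp⟩
    · rw [pow_zero, Matrix.one_apply_ne hij] at h
      exact absurd rfl h
  | succ k ih =>
    rw [pow_succ'] at h ⊢
    obtain ⟨m, hm⟩ := exists_mul_apply_eq h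
    obtain ⟨p, hp0, hpk, hp⟩ := ih m (right_ne_zero_of_mul (hm ▸ h))
    refine ⟨fun l => Nat.casesOn l i p, rfl, hpk, ?_⟩
    rw [hm, hp, Finset.prod_range_succ', mul_comm]
    simp [hp0]

theorem prod_walk_le (P : Mat n n) (p : ℕ → Fin n) (a k : ℕ) :
    ∏ l ∈ Finset.range k, P (p (a + l)) (p (a + l + 1)) ≤ (P ^ k) (p a) (p (a + k)) := by
  induction k with
  | zero => simp
  | succ k ih =>
    rw [Finset.prod_range_succ, pow_succ]
    exact (mul_le_mul_left ih _).trans (mul_apply_ge _ _ _ _ _)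

/-- A long walk contains a short closed walk. -/
theorem exists_pow_apply_le (P : Mat n n) {k : ℕ} (hk : n ≤ k) {i j : Fin n}
    (h : (P ^ k) i j ≠ 0) :
    ∃ (b : ℕ) (v : Fin n), 1 ≤ b ∧ b ≤ n ∧ (P ^ k) i j ≤ (P ^ b) v v * (P ^ (k - b)) i j := by
  obtain ⟨p, hp0, hpk, hp⟩ := exists_walk P k i j h
  obtain ⟨a, b, hab, hpab⟩ : ∃ a b : Fin (n + 1), a < b ∧ p a = p b := by
    obtain ⟨a, b, hne, hab⟩ := Fintype.exists_ne_map_eq_of_card_lt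
      (fun l : Fin (n + 1) => p l) (by simp)
    rcases lt_or_gt_of_ne hne with h | h
    · exact ⟨a, b, h, hab⟩
    · exact ⟨b, a, h, hab.symm⟩
  obtain ⟨a, ha⟩ := a
  obtain ⟨b, hb⟩ := b
  simp only [Fin.mk_lt_mk] at hab hpab
  obtain ⟨e, rfl⟩ := Nat.exists_eq_add_of_lt hab
  obtain ⟨c, rfl⟩ := Nat.exists_eq_add_of_le (show a + e + 1 ≤ k by omega)
  refine ⟨e + 1, p a, by omega, by omega, ?_⟩
  have h1 := prod_walk_le P p 0 a
  have h2 := prod_walk_le P p a (e + 1)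
  have h3 := prod_walk_le P p (a + e + 1) c
  simp only [zero_add] at h1
  rw [hp0] at h1
  rw [← add_assoc a e 1, ← hpab] at h2
  rw [hpk, ← hpab] at h3
  rw [hp, Finset.prod_range_add, add_assoc a e 1, Finset.prod_range_add]
  have hsub : a + e + 1 + c - (e + 1) = a + c := by omega
  rw [← add_assoc a e 1, hsub, pow_add P a c]
  calc _ ≤ (P ^ a) i (p a) * (P ^ (e + 1)) (p a) (p a) * (P ^ c) (p a) j :=
        mul_le_mul' (mul_le_mul' h1 h2) h3
    _ = (P ^ (e + 1)) (p a) (p a) * ((P ^ a) i (p a) * (P ^ c) (p a) j) := by ring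
    _ ≤ _ := mul_le_mul_right (mul_apply_ge _ _ _ _ _) _

/-- Removing closed walks of weight at most one bounds every power by the first `n`. Then `d i`, the
largest weight of a walk from `i`, is finite and cannot increase by prepending an edge. -/
theorem exists_potential_of_le_one {P : Mat n n}
    (h : ∀ b v, 1 ≤ b → b ≤ n → (P ^ b) v v ≤ 1) :
    ∃ d : Fin n → MaxPlus, (∀ i, d i ≠ 0) ∧ ∀ i j, P i j * d j ≤ d i := by
  have hbound : ∀ k i j, (P ^ k) i j ≤ ∑ l ∈ Finset.range n, (P ^ l) i j := by
    intro k
    induction k using Nat.strong_induction_on with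
    | _ k ih =>
      intro i j
      rcases lt_or_ge k n with hk | hk
      · exact le_sum (f := fun l => (P ^ l) i j) (Finset.mem_range.2 hk)
      · rcases eq_or_ne ((P ^ k) i j) 0 with h0 | h0
        · rw [h0]; exact zero_le
        · obtain ⟨b, v, hb, hbn, hle⟩ := exists_pow_apply_le P hk h0
          refine hle.trans ((mul_le_of_le_one_left' (h b v hb hbn)).trans (ih (k - b) ?_ i j))
          omega
  refine ⟨fun i => ∑ j, ∑ l ∈ Finset.range n, (P ^ l) i j, fun i => ?_, fun i j => ?_⟩
  · have h1 : (1 : MaxPlus) ≤ ∑ l ∈ Finset.range n, (P ^ l) i i := by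
      simpa using hbound 0 i i
    exact (zero_lt_one.trans_le (h1.trans
      (le_sum (f := fun j => ∑ l ∈ Finset.range n, (P ^ l) i j) (Finset.mem_univ i)))).ne'
  · simp only
    rw [Finset.mul_sum, sum_le_iff]
    intro m _
    rw [Finset.mul_sum, sum_le_iff]
    intro l _
    refine le_trans ?_
      (le_sum (f := fun j => ∑ l ∈ Finset.range n, (P ^ l) i j) (Finset.mem_univ m))
    refine le_trans ?_ (hbound (l + 1) i m)
    rw [pow_succ']
    exact mul_apply_ge _ _ _ _ _

/-- A matrix that is not nilpotent can be scaled so that it has a potential and a closed walk of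
weight one. -/
theorem exists_scale_potential {P : Mat n n} (hP : P ^ n ≠ 0) :
    ∃ (c : ℝ) (d : Fin n → MaxPlus), (∀ i, d i ≠ 0) ∧
      (∀ i j, (ofReal c • P) i j * d j ≤ d i) ∧ ∃ i b, 1 ≤ b ∧ ((ofReal c • P) ^ b) i i = 1 := by
  have hroot : ∀ (b : ℕ) (v : Fin n), ∃ y : MaxPlus, 1 ≤ b → y ^ b = (P ^ b) v v := fun b v => by
    rcases Nat.eq_zero_or_pos b with rfl | hb
    · exact ⟨0, by simp⟩
    · obtain ⟨y, hy⟩ := exists_pow_eq ((P ^ b) v v) hb.ne'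
      exact ⟨y, fun _ => hy⟩
  choose ρ hρ using hroot
  obtain ⟨b₁, v₁, hb₁, hb₁n, hne₁⟩ : ∃ b v, 1 ≤ b ∧ b ≤ n ∧ (P ^ b) v v ≠ 0 := by
    obtain ⟨i, j, hij⟩ : ∃ i j, (P ^ n) i j ≠ 0 := by
      by_contra! hcon
      exact hP (Matrix.ext hcon)
    obtain ⟨b, v, hb, hbn, hle⟩ := exists_pow_apply_le P le_rfl hij
    exact ⟨b, v, hb, hbn, left_ne_zero_of_mul (hij.pos.trans_le hle).ne'⟩
  -- The root `ρ b v` is the mean weight of a closed walk; scaling by the inverse of the largest one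
  -- makes all short closed walks at most one, with one equality.
  obtain ⟨⟨b, v⟩, hbv, hmax⟩ := Finset.exists_max_image (Finset.Icc 1 n ×ˢ Finset.univ)
    (fun x : ℕ × Fin n => ρ x.1 x.2) ⟨(b₁, v₁), by simp [hb₁, hb₁n]⟩
  simp only [Finset.mem_product, Finset.mem_Icc, Finset.mem_univ, and_true, Prod.forall,
    and_imp] at hbv hmax
  have hpos : ρ b v ≠ 0 := by
    have h1 : ρ b₁ v₁ ≠ 0 := fun h => hne₁ (by rw [← hρ b₁ v₁ hb₁, h, zero_pow (by omega)])
    exact (h1.pos.trans_le (hmax b₁ v₁ hb₁ hb₁n)).ne'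
  obtain ⟨c, hc⟩ := exists_eq_ofReal (inv_ne_zero hpos)
  have hscale : ∀ k i j, ((ofReal c • P) ^ k) i j = (ρ b v)⁻¹ ^ k * (P ^ k) i j := fun k i j => by
    rw [← hc, smul_pow]; rfl
  obtain ⟨d, hd, hPd⟩ := exists_potential_of_le_one (P := ofReal c • P) fun k w hk hkn => by
    rw [hscale, ← hρ k w hk, ← mul_pow]
    refine pow_le_one' ?_ k
    rw [← inv_mul_cancel₀ hpos]
    exact mul_le_mul_right (hmax k w hk hkn) _
  refine ⟨c, d, hd, hPd, v, b, hbv.1, ?_⟩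
  rw [hscale, ← hρ b v hbv.1, ← mul_pow, inv_mul_cancel₀ hpos, one_pow]

/-! ### Closures in the projective space -/

theorem proj_smul (c : ℝ) (A : Mat n m) : proj (ofReal c • A) = proj A :=
  (Quotient.sound (s := projSetoid n m) ⟨c, rfl⟩).symm

theorem smul_ofReal_ne_zero {c : ℝ} {A : Mat n m} (hA : A ≠ 0) : ofReal c • A ≠ 0 := by
  intro h
  apply hA
  have h' : ofReal (-c) • ofReal c • A = 0 := by rw [h, smul_zero]
  rwa [smul_smul, ← ofReal_add, neg_add_cancel, ofReal_zero, one_smul] at h'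

/-- The topology is coinduced from the nonnull matrices only, whence the exclusion of the null
matrix from `T` and from the limit. -/
theorem proj_mem_closure_image {T : Set (Mat n m)} (h0 : (0 : Mat n m) ∉ T) {B : Mat n m}
    (hB : B ∈ closure T) (hB0 : B ≠ 0) : proj B ∈ closure (proj '' T) := by
  have hcont : Continuous (fun A : {A : Mat n m // A ≠ 0} => proj A.1) := continuous_coinduced_rng
  have hmem : (⟨B, hB0⟩ : {A : Mat n m // A ≠ 0}) ∈
      closure ((Subtype.val : {A : Mat n m // A ≠ 0} → Mat n m) ⁻¹' T) := by
    rw [closure_subtype]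
    have : (Subtype.val : {A : Mat n m // A ≠ 0} → Mat n m) '' (Subtype.val ⁻¹' T) = T := by
      apply Set.Subset.antisymm
      · rintro _ ⟨A, hA, rfl⟩
        exact hA
      · exact fun A hA => ⟨⟨A, fun h' => h0 (h' ▸ hA)⟩, hA, rfl⟩
    rw [this]
    exact hB
  exact map_mem_closure (f := fun A : {A : Mat n m // A ≠ 0} => proj A.1) hcont hmem
    fun A hA => ⟨A.1, hA, rfl⟩

/-- A closed set stable under scaling is saturated, so its nonnull part has closed image. -/
theorem mem_of_proj_mem_closure {F T : Set (Mat n m)} (hF : IsClosed F)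
    (hscale : ∀ A ∈ F, ∀ c : ℝ, ofReal c • A ∈ F) (hT : ∀ A ∈ T, A ∈ F ∧ A ≠ 0) {B : Mat n m}
    (hB : proj B ∈ closure (proj '' T)) : B ∈ F ∧ B ≠ 0 := by
  have key : ∀ A B : Mat n m, proj A = proj B → A ∈ F ∧ A ≠ 0 → B ∈ F ∧ B ≠ 0 := by
    intro A B hAB hA
    obtain ⟨c, rfl⟩ := Quotient.exact hAB
    exact ⟨hscale A hA.1 c, smul_ofReal_ne_zero hA.2⟩
  have hclosed : IsClosed (proj '' {A : Mat n m | A ∈ F ∧ A ≠ 0}) := by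
    rw [isClosed_coinduced]
    convert hF.preimage (continuous_subtype_val (p := fun A : Mat n m => A ≠ 0)) using 1
    ext A
    constructor
    · rintro ⟨A', hA', h⟩
      exact (key A' A h hA').1
    · intro hA
      exact ⟨A, ⟨hA, A.2⟩, rfl⟩
  obtain ⟨A, hA, hAB⟩ := closure_minimal (Set.image_mono fun A hA => hT A hA) hclosed hB
  exact key A B hAB hA

/-! ### Idempotent limits of powers -/

theorem pow_mul_potential_le {P : Mat n n} {d : Fin n → MaxPlus}
    (hd : ∀ i j, P i j * d j ≤ d i) (k : ℕ) (i j : Fin n) : (P ^ k) i j * d j ≤ d i := by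
  induction k generalizing i with
  | zero =>
    rcases eq_or_ne i j with rfl | hij
    · simp
    · rw [pow_zero, Matrix.one_apply_ne hij, zero_mul]; exact zero_le
  | succ k ih =>
    rw [pow_succ', Matrix.mul_apply, Finset.sum_mul, sum_le_iff]
    intro l _
    rw [mul_assoc]
    exact (mul_le_mul_right (ih l) _).trans (hd i l)

/-- The potential bounds all powers, so their closure is a compact semigroup and contains an
idempotent. The closed walk of weight one keeps it from being null. -/
theorem exists_idempotent_limit {P : Mat n n} {d : Fin n → MaxPlus} (hd0 : ∀ i, d i ≠ 0)
    (hd : ∀ i j, P i j * d j ≤ d i) (hcycle : ∃ i b, 1 ≤ b ∧ (P ^ b) i i = 1) :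
    ∃ B ∈ closure {Q : Mat n n | ∃ k : ℕ, 1 ≤ k ∧ Q = P ^ k},
      B * B = B ∧ B ≠ 0 ∧ ∀ i j, B i j * d j ≤ d i := by
  set K : Set (Mat n n) := {Q | ∃ k : ℕ, 1 ≤ k ∧ Q = P ^ k} with hK
  have hentry : ∀ i j, Continuous fun A : Mat n n => A i j := fun i j =>
    continuous_id.matrix_elem i j
  have hpot : ∀ A ∈ closure K, ∀ i j, A i j * d j ≤ d i := by
    intro A hA i j
    refine closure_minimal (t := {A : Mat n n | A i j * d j ≤ d i}) ?_
      (isClosed_le ((hentry i j).mul continuous_const) continuous_const) hA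
    rintro _ ⟨k, -, rfl⟩
    exact pow_mul_potential_le hd k i j
  have hcompact : IsCompact (closure K) := by
    have hc : IsCompact (Set.univ.pi fun i => Set.univ.pi fun j => Set.Iic (d i * (d j)⁻¹) :
        Set (Fin n → Fin n → MaxPlus)) :=
      isCompact_univ_pi fun i => isCompact_univ_pi fun j => isCompact_Iic _
    refine hc.of_isClosed_subset isClosed_closure fun A hA => ?_
    intro i _ j _
    exact (le_mul_inv_iff₀ (hd0 j).pos).2 (hpot A hA i j)
  obtain ⟨i, b, hb, hib⟩ := hcycle
  have hlow : ∀ A ∈ closure K, d i ≤ ∑ l, A i l * d l := by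
    intro A hA
    refine closure_minimal (t := {A : Mat n n | d i ≤ ∑ l, A i l * d l}) ?_
      (isClosed_le continuous_const (continuous_finsetSum _ fun l _ =>
        (hentry i l).mul continuous_const)) hA
    rintro _ ⟨k, -, rfl⟩
    have hpow : ∀ k, 1 ≤ ((P ^ b) ^ k) i i := by
      intro k
      induction k with
      | zero => simp
      | succ k ih =>
        rw [pow_succ]
        refine le_trans ?_ (mul_apply_ge _ _ i i i)
        rwa [hib, mul_one]
    have hk := hpow k
    -- A closed walk of length `b * k` splits into `k` steps and a return; the potential bounds the
    -- return, leaving a lower bound on row `i` of `P ^ k`.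
    obtain ⟨e, rfl⟩ := Nat.exists_eq_add_of_le' hb
    rw [← pow_mul, add_mul, one_mul, add_comm, pow_add] at hk
    obtain ⟨l, hl⟩ := exists_mul_apply_eq (zero_lt_one.trans_le hk).ne'
    refine le_trans ?_ (le_sum (f := fun l => (P ^ k) i l * d l) (Finset.mem_univ l))
    calc d i ≤ (P ^ k) i l * (P ^ (e * k)) l i * d i := by
          rw [← hl]; exact le_mul_of_one_le_left' hk
      _ = (P ^ k) i l * ((P ^ (e * k)) l i * d i) := mul_assoc _ _ _
      _ ≤ _ := mul_le_mul_right (pow_mul_potential_le hd _ _ _) _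
  have hmul : ∀ x ∈ closure K, ∀ y ∈ closure K, x * y ∈ closure K := by
    intro x hx y hy
    refine map_mem_closure₂ continuous_mul hx hy ?_
    rintro _ ⟨k, hk, rfl⟩ _ ⟨l, hl, rfl⟩
    exact ⟨k + l, by omega, (pow_add P k l).symm⟩
  obtain ⟨B, hB, hBB⟩ := exists_idempotent_in_compact_subsemigroup
    (fun r : Mat n n => continuous_id.mul continuous_const) (closure K)
    ⟨P, subset_closure ⟨1, le_rfl, (pow_one P).symm⟩⟩ hcompact hmul
  refine ⟨B, hB, hBB, ?_, hpot B hB⟩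
  rintro rfl
  have := hlow 0 hB
  simp [hd0 i] at this

/-- In `B = B * B`, an entry of row `i` is not attained through the index `i`, since that would lose
the factor `B i i < 1`. -/
theorem hasRedundantRow_of_apply_lt_one {B : Mat n n} (hB : B * B = B) {i : Fin n}
    (hi : B i i < 1) : HasRedundantRow B := by
  refine ⟨i, fun j => B i j, ?_⟩
  ext k
  rw [Finset.sum_apply]
  apply le_antisymm
  · rcases eq_or_ne (B i k) 0 with h0 | h0
    · rw [h0]; exact zero_le
    · obtain ⟨j, hj⟩ := exists_mul_apply_eq (A := B) (B := B) (i := i) (j := k) (by rwa [hB])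
      rw [hB] at hj
      rw [hj]
      refine le_sum (f := fun j => (B i j • B j) k) (Finset.mem_erase.2 ⟨?_, Finset.mem_univ j⟩)
      rintro rfl
      exact (mul_lt_of_lt_one_left h0.pos hi).ne' hj
  · rw [sum_le_iff]
    intro j _
    exact (mul_apply_ge B B i j k).trans_eq (by rw [hB])

/-- Rows `i` and `j` are proportional. -/
theorem hasRedundantRow_of_one_le_mul {B : Mat n n} (hB : B * B = B) {i j : Fin n} (hij : i ≠ j)
    (h : 1 ≤ B i j * B j i) : HasRedundantRow B := by
  have hle : ∀ i j k, B i j * B j k ≤ B i k := fun i j k =>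
    (mul_apply_ge B B i j k).trans_eq (by rw [hB])
  refine ⟨i, fun l => if l = j then B i j else 0, ?_⟩
  rw [Finset.sum_eq_single_of_mem j (by simp [hij.symm]) (fun l _ hl => by simp [hl])]
  ext k
  simp only [if_true, Pi.smul_apply, smul_eq_mul]
  refine le_antisymm ?_ (hle i j k)
  calc B i k ≤ B i j * B j i * B i k := le_mul_of_one_le_left' h
    _ = B i j * (B j i * B i k) := mul_assoc _ _ _
    _ ≤ _ := mul_le_mul_right (hle j i k) _

/-- An idempotent matrix with unit diagonal, no nontrivial cycle of weight one and a potential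
has a strict potential. -/
theorem exists_strict_potential {B : Mat n n} (hB : B * B = B) (hdiag : ∀ i, B i i = 1)
    (hlt : ∀ i j, i ≠ j → B i j * B j i < 1) {d : Fin n → MaxPlus} (hd0 : ∀ i, d i ≠ 0)
    (hd : ∀ i j, B i j * d j ≤ d i) :
    ∃ e : Fin n → ℝ, ∀ i j, i ≠ j → B i j * ofReal (e j) < ofReal (e i) := by
  have hle : ∀ i j k, B i j * B j k ≤ B i k := fun i j k =>
    (mul_apply_ge B B i j k).trans_eq (by rw [hB])
  obtain ⟨c, hc0, hc⟩ : ∃ c : MaxPlus, c ≠ 0 ∧ ∀ i, c * d i < 1 := by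
    have hm : 0 < 1 + ∑ i, d i := by
      rw [add_eq_max]; exact zero_lt_one.trans_le (le_max_left _ _)
    refine ⟨ofReal (-1) * (1 + ∑ i, d i)⁻¹, mul_ne_zero (ofReal_ne_zero _) (inv_ne_zero hm.ne'),
      fun i => ?_⟩
    have h1 : d i ≤ 1 + ∑ i, d i := by
      rw [add_eq_max]; exact (le_sum (Finset.mem_univ i)).trans (le_max_right _ _)
    have h2 : (1 + ∑ i, d i)⁻¹ * d i ≤ 1 := by
      exact (mul_le_mul_right h1 _).trans_eq (inv_mul_cancel₀ hm.ne')
    rw [mul_assoc]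
    refine (mul_le_of_le_one_right' h2).trans_lt ?_
    rw [← ofReal_zero, ofReal_lt_ofReal]
    norm_num
  -- Column `k` of `B` is a potential that is strict in row `k`. Adding `c * d` makes it finite, and
  -- `c * d i < 1` preserves the strictness.
  have hv0 : ∀ k i, B i k + c * d i ≠ 0 := fun k i => by
    rw [add_eq_max]
    exact ((mul_ne_zero hc0 (hd0 i)).pos.trans_le (le_max_right _ _)).ne'
  have hv : ∀ k i j, B i j * (B j k + c * d j) ≤ B i k + c * d i := fun k i j => by
    rw [mul_add, add_eq_max, add_eq_max]
    refine max_le_max (hle i j k) ?_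
    rw [mul_left_comm]
    exact mul_le_mul_right (hd i j) _
  have hv' : ∀ i j, i ≠ j → B i j * (B j i + c * d j) < B i i + c * d i := fun i j hij => by
    rw [mul_add, add_eq_max, add_eq_max, hdiag]
    refine lt_of_lt_of_le (max_lt (hlt i j hij) ?_) (le_max_left _ _)
    rw [mul_left_comm]
    exact (mul_le_mul_right (hd i j) _).trans_lt (hc i)
  choose w hw using fun k i => exists_eq_ofReal (hv0 k i)
  -- In the mean over `k`, the summand `k = i` gives strictness in row `i`.
  refine ⟨fun i => (∑ k, w k i) / n, fun i j hij => ?_⟩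
  rcases eq_or_ne (B i j) 0 with h0 | h0
  · rw [h0, zero_mul]; exact ofReal_pos _
  · obtain ⟨β, hβ⟩ := exists_eq_ofReal h0
    simp only [hw] at hv hv'
    have h1 : ∀ k, β + w k j ≤ w k i := fun k => by
      have := hv k i j
      rwa [hβ, ← ofReal_add, ofReal_le_ofReal] at this
    have h2 : β + w i j < w i i := by
      have := hv' i j hij
      rwa [hβ, ← ofReal_add, ofReal_lt_ofReal] at this
    have h3 : ∑ k, (β + w k j) < ∑ k, w k i :=
      Finset.sum_lt_sum (fun k _ => h1 k) ⟨i, Finset.mem_univ i, h2⟩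
    rw [Finset.sum_add_distrib, Finset.sum_const, Finset.card_univ, Fintype.card_fin,
      nsmul_eq_mul] at h3
    have hn : (0 : ℝ) < n := Nat.cast_pos.2 i.pos
    rw [hβ, ← ofReal_add, ofReal_lt_ofReal, lt_div_iff₀ hn, add_mul, div_mul_cancel₀ _ hn.ne']
    linarith

/-! ### Matrices of maximal ultimate rank -/

/-- No limit of powers of `P` has both a redundant row and a redundant column. -/
def NoRedundantLimit (P : Mat n n) : Prop :=
  ∀ B : Mat n n, proj B ∈ closure {x | ∃ k : ℕ, 1 ≤ k ∧ x = proj (P ^ k)} →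
    ¬ (HasRedundantRow B ∧ HasRedundantRow B.transpose)

theorem noRedundantLimit_of_urk_eq {t : RankNotion} {P : Mat n n} (h : urk t P = n) :
    NoRedundantLimit P := by
  rintro B hB ⟨h1, h2⟩
  have h3 : urk t P ≤ rk t B := Nat.sInf_le ⟨B, hB, rfl⟩
  exact (h.symm.trans_le h3).not_gt (rk_lt t h1 h2)

theorem hasRedundantRow_zero (hn : 0 < n) : HasRedundantRow (0 : Mat n m) :=
  ⟨⟨0, hn⟩, 0, by simp; rfl⟩

/-- Both failures of strictness for the idempotent limit are symmetric under transposition, so each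
would yield a redundant row and a redundant column at once. -/
theorem NoRedundantLimit.exists_strict_limit (hn : 0 < n) {P : Mat n n}
    (hP : NoRedundantLimit P) :
    ∃ (c : ℝ) (B : Mat n n) (e : Fin n → ℝ),
      B ∈ closure {Q : Mat n n | ∃ k : ℕ, 1 ≤ k ∧ Q = (ofReal c • P) ^ k} ∧
      (∀ i, B i i = 1) ∧ (∀ i j, i ≠ j → B i j * ofReal (e j) < ofReal (e i)) ∧
      ∀ i, (ofReal c • P) i i ≤ 1 := by
  have hpow : ∀ k, 1 ≤ k → P ^ k ≠ 0 := by
    intro k hk h0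
    refine hP (P ^ k) (subset_closure ⟨k, hk, rfl⟩) ?_
    rw [h0]
    exact ⟨hasRedundantRow_zero hn, hasRedundantRow_zero hn⟩
  obtain ⟨c, d, hd0, hd, hcycle⟩ := exists_scale_potential (hpow n hn)
  obtain ⟨B, hB, hBB, hB0, hBd⟩ := exists_idempotent_limit hd0 hd hcycle
  have hscale : ∀ k : ℕ, (ofReal c • P) ^ k = ofReal (k * c) • P ^ k := fun k => by
    rw [smul_pow, ofReal_nsmul]
  have hmem : proj B ∈ closure {x | ∃ k : ℕ, 1 ≤ k ∧ x = proj (P ^ k)} := by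
    refine closure_mono ?_ (proj_mem_closure_image ?_ hB hB0)
    · rintro _ ⟨_, ⟨k, hk, rfl⟩, rfl⟩
      exact ⟨k, hk, by rw [hscale, proj_smul]⟩
    · rintro ⟨k, hk, h⟩
      rw [hscale] at h
      exact smul_ofReal_ne_zero (hpow k hk) h.symm
  have hred := hP B hmem
  have hBT : B.transpose * B.transpose = B.transpose := by rw [← Matrix.transpose_mul, hBB]
  have hle : ∀ A : Mat n n, (∀ i j, A i j * d j ≤ d i) → ∀ i, A i i ≤ 1 := fun A hA i => by
    have h := hA i i
    rw [← one_mul (d i)] at h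
    exact le_of_mul_le_mul_right (by simpa using h) (hd0 i).pos
  have hdiag : ∀ i, B i i = 1 := fun i => by
    refine le_antisymm (hle B hBd i) (not_lt.1 fun hlt => hred ?_)
    exact ⟨hasRedundantRow_of_apply_lt_one hBB hlt, hasRedundantRow_of_apply_lt_one hBT hlt⟩
  have hlt : ∀ i j, i ≠ j → B i j * B j i < 1 := fun i j hij => by
    refine not_le.1 fun hge => hred ?_
    refine ⟨hasRedundantRow_of_one_le_mul hBB hij hge, hasRedundantRow_of_one_le_mul hBT hij ?_⟩
    rwa [mul_comm] at hge
  obtain ⟨e, he⟩ := exists_strict_potential hBB hdiag hlt hd0 hBd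
  exact ⟨c, B, e, hB, hdiag, he, hle _ hd⟩

theorem Dominant.smul {σ : Equiv.Perm (Fin n)} {u v : Fin n → MaxPlus} {A : Mat n n}
    (h : Dominant σ u v A) (c : ℝ) :
    Dominant σ (fun i => ofReal c * u i) v (ofReal c • A) where
  left_ne i := mul_ne_zero (ofReal_ne_zero c) (h.left_ne i)
  right_ne := h.right_ne
  apply_eq i := by rw [Matrix.smul_apply, h.apply_eq, smul_eq_mul, mul_assoc]
  apply_lt i j hij := by
    rw [Matrix.smul_apply, smul_eq_mul, mul_assoc]
    exact mul_lt_mul_of_pos_left (h.apply_lt i j hij) (ofReal_pos c)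

/-- Strictness of the limit is open, so some power of `P` has the identity as dominant permutation;
`P` is a factor of it. -/
theorem NoRedundantLimit.exists_dominant (hn : 0 < n) {P : Mat n n} (hP : NoRedundantLimit P) :
    ∃ σ u v, Dominant σ u v P := by
  obtain ⟨c, B, e, hB, hdiag, he, -⟩ := hP.exists_strict_limit hn
  have hentry : ∀ i j, Continuous fun A : Mat n n => A i j := fun i j =>
    continuous_id.matrix_elem i j
  have hopen : IsOpen {A : Mat n n | (∀ i, 0 < A i i) ∧
      ∀ i j, i ≠ j → A i j * ofReal (e j) < A i i * ofReal (e i)} := by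
    refine IsOpen.and ?_ ?_
    · simp only [Set.ofPred_forall]
      exact isOpen_iInter_of_finite fun i => isOpen_lt continuous_const (hentry i i)
    · simp only [Set.ofPred_forall]
      exact isOpen_iInter_of_finite fun i => isOpen_iInter_of_finite fun j =>
        isOpen_iInter_of_finite fun _ => isOpen_lt ((hentry i j).mul continuous_const)
          ((hentry i i).mul continuous_const)
  obtain ⟨_, ⟨hpos, hlt⟩, k, hk, rfl⟩ := mem_closure_iff.1 hB _ hopen
    ⟨fun i => by rw [hdiag]; exact zero_lt_one, fun i j hij => by
      rw [hdiag, one_mul]; exact he i j hij⟩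
  have hcancel : ∀ x : ℝ, ofReal x * ofReal (-x) = 1 := fun x => by
    rw [← ofReal_add, add_neg_cancel, ofReal_zero]
  have hdom : Dominant 1 (fun i => ((ofReal c • P) ^ k) i i * ofReal (e i))
      (fun j => ofReal (-e j)) ((ofReal c • P) ^ k) :=
    { left_ne := fun i => mul_ne_zero (hpos i).ne' (ofReal_ne_zero _)
      right_ne := fun j => ofReal_ne_zero _
      apply_eq := fun i => by
        rw [Equiv.Perm.one_apply, mul_assoc, hcancel, mul_one]
      apply_lt := fun i j hij => by
        have h1 := mul_lt_mul_of_pos_right (hlt i j (Ne.symm hij)) (ofReal_pos (-e j))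
        rwa [mul_assoc, hcancel, mul_one] at h1 }
  obtain ⟨k, rfl⟩ := Nat.exists_eq_add_of_le' hk
  rw [pow_succ'] at hdom
  obtain ⟨κ, w, hκ, -⟩ := hdom.of_mul
  have hdomP := hκ.smul (-c)
  rw [smul_smul, ← ofReal_add, neg_add_cancel, ofReal_zero, one_smul] at hdomP
  exact ⟨_, _, _, hdomP⟩

/-- If the diagonal of `P` is multiplicative along powers, then it is constant, and `P` has a
strict potential. -/
theorem NoRedundantLimit.exists_diag_potential (hn : 0 < n) {P : Mat n n}
    (hP : NoRedundantLimit P) (hdiagP : ∀ k i, 1 ≤ k → (P ^ k) i i = P i i ^ k) :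
    ∃ (a : ℝ) (e : Fin n → ℝ), (∀ i, P i i = ofReal a) ∧
      ∀ i j, i ≠ j → P i j * ofReal (e j) < ofReal (a + e i) := by
  obtain ⟨c, B, e, hB, hdiag, he, hle⟩ := hP.exists_strict_limit hn
  have hentry : ∀ i j, Continuous fun A : Mat n n => A i j := fun i j =>
    continuous_id.matrix_elem i j
  -- Since the diagonal is at most one, its powers stay below it; the limit one forces equality.
  have hone : ∀ i, (ofReal c • P) i i = 1 := by
    intro i
    refine le_antisymm (hle i) ?_
    rw [← hdiag i]
    refine closure_minimal (t := {A : Mat n n | A i i ≤ (ofReal c • P) i i}) ?_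
      (isClosed_le (hentry i i) continuous_const) hB
    rintro _ ⟨k, hk, rfl⟩
    have : ((ofReal c • P) ^ k) i i = ((ofReal c • P) i i) ^ k := by
      rw [smul_pow, Matrix.smul_apply, hdiagP k i hk, Matrix.smul_apply, smul_eq_mul, smul_eq_mul,
        mul_pow]
    change ((ofReal c • P) ^ k) i i ≤ _
    rw [this]
    obtain ⟨k, rfl⟩ := Nat.exists_eq_add_of_le' hk
    rw [pow_succ]
    exact mul_le_of_le_one_left' (pow_le_one' (hle i) k)
  -- With unit diagonal the powers increase, so the scaled `P` lies below `B` and inherits its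
  -- strict potential.
  have hPB : ∀ i j, (ofReal c • P) i j ≤ B i j := by
    intro i j
    refine closure_minimal (t := {A : Mat n n | (ofReal c • P) i j ≤ A i j}) ?_
      (isClosed_le continuous_const (hentry i j)) hB
    rintro _ ⟨k, hk, rfl⟩
    obtain ⟨k, rfl⟩ := Nat.exists_eq_add_of_le' hk
    change _ ≤ ((ofReal c • P) ^ (k + 1)) i j
    clear hk
    induction k with
    | zero => simp
    | succ k ih =>
      rw [pow_succ]
      refine le_trans ?_ (mul_apply_ge _ _ i j j)
      rwa [hone, mul_one]
  have hcP : ∀ i j, P i j = ofReal (-c) * (ofReal c • P) i j := fun i j => by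
    rw [Matrix.smul_apply, smul_eq_mul, ← mul_assoc, ← ofReal_add, neg_add_cancel, ofReal_zero,
      one_mul]
  refine ⟨-c, e, fun i => by rw [hcP, hone, mul_one], fun i j hij => ?_⟩
  rw [hcP, mul_assoc, ofReal_add]
  exact mul_lt_mul_of_pos_left ((mul_le_mul_left (hPB i j) _).trans_lt (he i j hij)) (ofReal_pos _)

/-! ### Semigroups of matrices with dominant permutations -/

/-- A semigroup of matrices, each with a dominant permutation `σ A` along which its entries are
given by `a A`, that is multiplicative along dominant entries, and whose elements with trivial
permutation have a constant diagonal and a strict potential. -/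
structure DominantSystem (S : Subsemigroup (Mat n n)) (σ : Mat n n → Equiv.Perm (Fin n))
    (a : Mat n n → Fin n → ℝ) : Prop where
  apply_eq : ∀ A ∈ S, ∀ i, A i (σ A i) = ofReal (a A i)
  perm_mul : ∀ A ∈ S, ∀ B ∈ S, σ (A * B) = σ B * σ A
  weight_mul : ∀ A ∈ S, ∀ B ∈ S, ∀ i, a (A * B) i = a A i + a B (σ A i)
  exists_potential : ∀ A ∈ S, σ A = 1 → ∃ (α : ℝ) (e : Fin n → ℝ), (∀ i, a A i = α) ∧
    ∀ i j, i ≠ j → A i j * ofReal (e j) < ofReal (α + e i)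

theorem exists_dominantSystem (hn : 0 < n) {S : Subsemigroup (Mat n n)}
    (hS : ∀ P ∈ S, NoRedundantLimit P) : ∃ σ a, DominantSystem S σ a := by
  have h : ∀ A : Mat n n, ∃ (σ : Equiv.Perm (Fin n)) (a : Fin n → ℝ), A ∈ S →
      (∃ u v, Dominant σ u v A) ∧ ∀ i, A i (σ i) = ofReal (a i) := by
    intro A
    by_cases hA : A ∈ S
    · obtain ⟨σ, u, v, hσ⟩ := (hS A hA).exists_dominant hn
      choose a ha using fun i => exists_eq_ofReal (hσ.apply_ne_zero i)
      exact ⟨σ, a, fun _ => ⟨⟨u, v, hσ⟩, ha⟩⟩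
    · exact ⟨1, 0, fun h => absurd h hA⟩
  choose σ a h using h
  have hmul : ∀ A ∈ S, ∀ B ∈ S, σ (A * B) = σ B * σ A ∧
      ∀ i, a (A * B) i = a A i + a B (σ A i) := by
    intro A hA B hB
    obtain ⟨⟨u, v, hAB⟩, hABa⟩ := h (A * B) (S.mul_mem hA hB)
    obtain ⟨⟨uA, vA, hdA⟩, hAa⟩ := h A hA
    obtain ⟨⟨uB, vB, hdB⟩, hBa⟩ := h B hB
    obtain ⟨κ, w, hκ, hκ', heq⟩ := hAB.of_mul
    -- Uniqueness of dominant permutations identifies those produced by factoring `A * B` with the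
    -- chosen `σ A` and `σ B`.
    obtain rfl := hdA.unique hκ
    have hBκ := hdB.unique hκ'
    have hσ : σ (A * B) = σ B * σ A := by rw [hBκ, inv_mul_cancel_right]
    refine ⟨hσ, fun i => ?_⟩
    have h1 := heq i
    rw [hABa, hAa, hσ, Equiv.Perm.mul_apply, hBa, ← ofReal_add, ofReal_inj] at h1
    exact h1
  refine ⟨σ, a, fun A hA => (h A hA).2, fun A hA B hB => (hmul A hA B hB).1,
    fun A hA B hB => (hmul A hA B hB).2, fun A hA hσ => ?_⟩
  have hdiag : ∀ i, A i i = ofReal (a A i) := fun i => by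
    have := (h A hA).2 i
    rwa [hσ, Equiv.Perm.one_apply] at this
  have hpow : ∀ k : ℕ, A ^ (k + 1) ∈ S ∧ σ (A ^ (k + 1)) = 1 ∧
      ∀ i, (A ^ (k + 1)) i i = A i i ^ (k + 1) := by
    intro k
    induction k with
    | zero => simpa using ⟨hA, hσ⟩
    | succ k ih =>
      obtain ⟨hk, hσk, hdk⟩ := ih
      have hmem : A ^ (k + 1 + 1) ∈ S := by rw [pow_succ]; exact S.mul_mem hk hA
      have hσ' : σ (A ^ (k + 1 + 1)) = 1 := by
        rw [pow_succ, (hmul _ hk _ hA).1, hσ, hσk, one_mul]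
      refine ⟨hmem, hσ', fun i => ?_⟩
      have h1 := (h _ hmem).2 i
      have h2 := (h _ hk).2 i
      rw [hσ', Equiv.Perm.one_apply] at h1
      rw [hσk, Equiv.Perm.one_apply, hdk] at h2
      rw [h1, pow_succ A, (hmul _ hk _ hA).2, hσk, Equiv.Perm.one_apply, ofReal_add, ← h2, ← hdiag,
        pow_succ (A i i) (k + 1)]
  obtain ⟨α, e, hα, he⟩ := (hS A hA).exists_diag_potential hn fun k i hk => by
    obtain ⟨k, rfl⟩ := Nat.exists_eq_add_of_le' hk
    exact (hpow k).2.2 i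
  exact ⟨α, e, fun i => ofReal_inj.1 (by rw [← hdiag, hα]), he⟩

namespace DominantSystem

variable {S : Subsemigroup (Mat n n)} {σ : Mat n n → Equiv.Perm (Fin n)}
  {a : Mat n n → Fin n → ℝ}

/-- The mean of the dominant entries. -/
def mean (a : Mat n n → Fin n → ℝ) (A : Mat n n) : ℝ := (∑ i, a A i) / n

theorem mean_mul (h : DominantSystem S σ a) {A B : Mat n n} (hA : A ∈ S) (hB : B ∈ S) :
    mean a (A * B) = mean a A + mean a B := by
  rw [mean, mean, mean, ← add_div, Finset.sum_congr rfl fun i _ => h.weight_mul A hA B hB i,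
    Finset.sum_add_distrib, Equiv.sum_comp (σ A) (a B)]

theorem weight_eq_mean (h : DominantSystem S σ a) {A : Mat n n} (hA : A ∈ S) (hσ : σ A = 1)
    (i : Fin n) : a A i = mean a A := by
  obtain ⟨α, -, hα, -⟩ := h.exists_potential A hA hσ
  have hn : (n : ℝ) ≠ 0 := Nat.cast_ne_zero.2 i.pos.ne'
  rw [mean, Finset.sum_congr rfl fun i _ => hα i, hα i, Finset.sum_const, Finset.card_univ,
    Fintype.card_fin, nsmul_eq_mul, mul_div_cancel_left₀ _ hn]

theorem apply_self (h : DominantSystem S σ a) {A : Mat n n} (hA : A ∈ S) (hσ : σ A = 1)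
    (i : Fin n) : A i i = ofReal (mean a A) := by
  have := h.apply_eq A hA i
  rwa [hσ, Equiv.Perm.one_apply, h.weight_eq_mean hA hσ] at this

/-- The permutations form a finite semigroup, hence a group. -/
theorem exists_perm_eq_inv (h : DominantSystem S σ a) {A : Mat n n} (hA : A ∈ S) :
    ∃ A' ∈ S, σ A' = (σ A)⁻¹ := by
  have hpow : ∀ k : ℕ, A ^ (k + 1) ∈ S ∧ σ (A ^ (k + 1)) = σ A ^ (k + 1) := by
    intro k
    induction k with
    | zero => simpa using hA
    | succ k ih =>
      rw [pow_succ]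
      exact ⟨S.mul_mem ih.1 hA, by rw [h.perm_mul _ ih.1 _ hA, ih.2, ← pow_succ']⟩
  obtain ⟨o, ho⟩ : ∃ o, orderOf (σ A) = o + 1 :=
    ⟨orderOf (σ A) - 1, (Nat.sub_add_cancel (orderOf_pos _)).symm⟩
  have h1 : σ A ^ (o + 1) = 1 := ho ▸ pow_orderOf_eq_one _
  -- The exponent `o` would also give the inverse, but it may be zero, and `A ^ 0` need not lie in
  -- `S`.
  refine ⟨A ^ (2 * o + 1), (hpow _).1, ?_⟩
  rw [(hpow _).2, eq_inv_iff_mul_eq_one, ← pow_succ, show 2 * o + 1 + 1 = (o + 1) * 2 by ring,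
    pow_mul, h1, one_pow]

/-- Finitely many elements with trivial permutation are dominated by a single one. -/
theorem exists_dominating (h : DominantSystem S σ a) (hS : (S : Set (Mat n n)).Nonempty)
    {T : Set (Mat n n)} (hT : T.Finite) (hTS : ∀ X ∈ T, X ∈ S ∧ σ X = 1) :
    ∃ U ∈ S, σ U = 1 ∧ ∀ X ∈ T, ∀ i j, X i j * ofReal (mean a U) ≤ U i j * ofReal (mean a X) := by
  induction T, hT using Set.Finite.induction_on with
  | empty =>
    obtain ⟨A, hA⟩ := hS
    obtain ⟨A', hA', hσ⟩ := h.exists_perm_eq_inv hA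
    exact ⟨A * A', S.mul_mem hA hA', by rw [h.perm_mul A hA A' hA', hσ, inv_mul_cancel], by simp⟩
  | @insert X T _ _ ih =>
    obtain ⟨U, hU, hσU, hdom⟩ := ih fun Y hY => hTS Y (Set.mem_insert_of_mem _ hY)
    obtain ⟨hX, hσX⟩ := hTS X (Set.mem_insert _ _)
    -- Both diagonals are constant and equal to the means, so `U * X` dominates `X` through `U i i`
    -- and `U` through `X j j`.
    refine ⟨U * X, S.mul_mem hU hX, by rw [h.perm_mul U hU X hX, hσU, hσX, one_mul], ?_⟩
    rintro Y (rfl | hY) i j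
    · rw [h.mean_mul hU hX, ofReal_add, ← mul_assoc]
      refine mul_le_mul_left ?_ _
      rw [mul_comm, ← h.apply_self hU hσU i]
      exact mul_apply_ge _ _ _ _ _
    · rw [h.mean_mul hU hX, ofReal_add, ← mul_assoc]
      calc _ ≤ U i j * ofReal (mean a Y) * ofReal (mean a X) := mul_le_mul_left (hdom Y hY i j) _
        _ = U i j * X j j * ofReal (mean a Y) := by rw [h.apply_self hX hσX j]; ring
        _ ≤ _ := mul_le_mul_left (mul_apply_ge _ _ _ _ _) _

/-- A potential for one dominating matrix with trivial permutation is transported to a family `f g`,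
`g ∈ H`, with each generator `A` relating `f (σ A * g)` to `f g`. Averaging over `H` removes the
dependence on `g`. -/
theorem exists_common_potential (h : DominantSystem S σ a) (hS : (S : Set (Mat n n)).Nonempty)
    {G : Set (Mat n n)} (hG : G.Finite) (hGS : G ⊆ S) :
    ∃ e : Fin n → ℝ, ∀ A ∈ G, ∀ i, a A i + e (σ A i) = mean a A + e i ∧
      ∀ j, j ≠ σ A i → A i j * ofReal (e j) < ofReal (mean a A + e i) := by
  classical
  let H : Finset (Equiv.Perm (Fin n)) := Finset.univ.filter fun g => ∃ A ∈ S, σ A = g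
  have hH : ∀ {g}, g ∈ H ↔ ∃ A ∈ S, σ A = g := by simp [H]
  have hHinv : ∀ {g}, g ∈ H → g⁻¹ ∈ H := by
    intro g hg
    obtain ⟨A, hA, rfl⟩ := hH.1 hg
    exact hH.2 (h.exists_perm_eq_inv hA)
  have hHmul : ∀ {g g'}, g ∈ H → g' ∈ H → g * g' ∈ H := by
    intro g g' hg hg'
    obtain ⟨A, hA, rfl⟩ := hH.1 hg
    obtain ⟨B, hB, rfl⟩ := hH.1 hg'
    exact hH.2 ⟨B * A, S.mul_mem hB hA, h.perm_mul B hB A hA⟩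
  have hHcard : (0 : ℝ) < H.card := by
    obtain ⟨A, hA⟩ := hS
    exact Nat.cast_pos.2 (Finset.card_pos.2 ⟨σ A, hH.2 ⟨A, hA, rfl⟩⟩)
  have hW : ∀ g, ∃ A, g ∈ H → A ∈ S ∧ σ A = g := fun g => by
    by_cases hg : g ∈ H
    · obtain ⟨A, hA⟩ := hH.1 hg
      exact ⟨A, fun _ => hA⟩
    · exact ⟨0, fun h => absurd h hg⟩
  choose W hW using hW
  -- The last factor returns from `σ A * g` to the identity, so these finitely many products have
  -- trivial permutation.
  let X : Equiv.Perm (Fin n) × Mat n n → Mat n n := fun p =>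
    W p.1 * p.2 * W (σ p.2 * p.1)⁻¹
  have hσH : ∀ {A}, A ∈ G → σ A ∈ H := fun hA => hH.2 ⟨_, hGS hA, rfl⟩
  have hX : ∀ g ∈ H, ∀ A ∈ G, X (g, A) ∈ S ∧ σ (X (g, A)) = 1 ∧
      mean a (X (g, A)) = mean a (W g) + mean a A + mean a (W (σ A * g)⁻¹) := by
    intro g hg A hA
    obtain ⟨h1, h2⟩ := hW g hg
    obtain ⟨h3, h4⟩ := hW (σ A * g)⁻¹ (hHinv (hHmul (hσH hA) hg))
    have h5 := S.mul_mem h1 (hGS hA)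
    refine ⟨S.mul_mem h5 h3, ?_, ?_⟩
    · simp only [X]
      rw [h.perm_mul _ h5 _ h3, h4, h.perm_mul _ h1 _ (hGS hA), h2, inv_mul_cancel]
    · simp only [X]
      rw [h.mean_mul h5 h3, h.mean_mul h1 (hGS hA)]
  obtain ⟨U, hU, hσU, hdom⟩ := h.exists_dominating hS
    (T := X '' ((H : Set (Equiv.Perm (Fin n))) ×ˢ G)) ((H.finite_toSet.prod hG).image _) (by
      rintro _ ⟨⟨g, A⟩, ⟨hg, hA⟩, rfl⟩
      exact ⟨(hX g hg A hA).1, (hX g hg A hA).2.1⟩)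
  obtain ⟨α, d, hα, hd⟩ := h.exists_potential U hU hσU
  -- Chosen so that the dominant entries of `W g`, normalized by their mean, are tight from `d` to
  -- `f g`.
  let f : Equiv.Perm (Fin n) → Fin n → ℝ := fun g i => d (g⁻¹ i) - a (W g) (g⁻¹ i) + mean a (W g)
  have hf : ∀ g i, f g (g i) = d i - a (W g) i + mean a (W g) := fun g i => by
    have : g⁻¹ (g i) = i := g.symm_apply_apply i
    simp only [f, this]
  have hback : ∀ g ∈ H, ∀ i, a (W g) i + a (W g⁻¹) (g i) = mean a (W g) + mean a (W g⁻¹) := by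
    intro g hg i
    obtain ⟨h1, h2⟩ := hW g hg
    obtain ⟨h3, h4⟩ := hW g⁻¹ (hHinv hg)
    have h5 := h.weight_mul _ h1 _ h3 i
    rw [h.weight_eq_mean (S.mul_mem h1 h3)
      (by rw [h.perm_mul _ h1 _ h3, h2, h4, inv_mul_cancel]), h.mean_mul h1 h3, h2] at h5
    exact h5.symm
  have heq : ∀ g ∈ H, ∀ A ∈ G, ∀ i, a A i + f (σ A * g) (σ A i) = mean a A + f g i := by
    intro g hg A hA i
    obtain ⟨i, rfl⟩ := g.surjective i
    obtain ⟨h1, h2⟩ := hW g hg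
    have hg' := hHmul (hσH hA) hg
    obtain ⟨h3, h4⟩ := hW (σ A * g)⁻¹ (hHinv hg')
    obtain ⟨hXS, hXσ, hXm⟩ := hX g hg A hA
    have h5 := S.mul_mem h1 (hGS hA)
    have h6 := h.weight_eq_mean hXS hXσ i
    rw [hXm] at h6
    simp only [X] at h6
    rw [h.weight_mul _ h5 _ h3, h.weight_mul _ h1 _ (hGS hA), h.perm_mul _ h1 _ (hGS hA), h2] at h6
    have h7 := hback _ hg' i
    have h8 := hf (σ A * g) i
    rw [Equiv.Perm.mul_apply] at h8
    rw [h8, hf]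
    linarith
  have hlt : ∀ g ∈ H, ∀ A ∈ G, ∀ i j, j ≠ σ A i → ∀ x : ℝ, A i j = ofReal x →
      x + f (σ A * g) j < mean a A + f g i := by
    intro g hg A hA i j hij x hx
    obtain ⟨i, rfl⟩ := g.surjective i
    obtain ⟨j, rfl⟩ := (σ A * g).surjective j
    have hne : i ≠ j := fun h => hij (by rw [h]; rfl)
    obtain ⟨h1, h2⟩ := hW g hg
    have hg' := hHmul (hσH hA) hg
    obtain ⟨h3, h4⟩ := hW (σ A * g)⁻¹ (hHinv hg')
    obtain ⟨hXS, hXσ, hXm⟩ := hX g hg A hA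
    have h5 := S.mul_mem h1 (hGS hA)
    have e1 := h.apply_eq _ h1 i
    have e2 := h.apply_eq _ h3 ((σ A * g) j)
    rw [h2] at e1
    rw [h4, show (σ A * g)⁻¹ ((σ A * g) j) = j from (σ A * g).symm_apply_apply j] at e2
    -- The entry of `A` is completed by dominant entries of the two representatives into a lower
    -- bound for `X (g, A) i j`, which `U` and its strict potential bound above.
    have h6 : ofReal (a (W g) i + x + a (W (σ A * g)⁻¹) ((σ A * g) j)) ≤ X (g, A) i j := by
      rw [ofReal_add, ofReal_add, ← e1, ← hx, ← e2]
      exact (mul_le_mul_left (mul_apply_ge _ _ _ _ _) _).trans (mul_apply_ge _ _ _ _ _)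
    have h7 := hdom _ ⟨(g, A), ⟨hg, hA⟩, rfl⟩ i j
    have h8 := (mul_le_mul_left h6 (ofReal (mean a U))).trans h7
    have h9 := (mul_le_mul_left h8 (ofReal (d j))).trans_lt
      (show _ < ofReal (α + d i) * ofReal (mean a (X (g, A))) by
        rw [mul_right_comm]
        exact mul_lt_mul_of_pos_right (hd i j hne) (ofReal_pos _))
    rw [← ofReal_add, ← ofReal_add, ← ofReal_add, ofReal_lt_ofReal, hXm] at h9
    have h10 : α = mean a U := by rw [← hα i, h.weight_eq_mean hU hσU]
    have h11 := hback _ hg' j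
    rw [hf, hf]
    linarith
  clear_value f
  refine ⟨fun i => (∑ g ∈ H, f g i) / H.card, fun A hA i => ?_⟩
  -- Left translation by `σ A` permutes `H`.
  have hsum : ∀ j, ∑ g ∈ H, f (σ A * g) j = ∑ g ∈ H, f g j := fun j =>
    Finset.sum_equiv (Equiv.mulLeft (σ A)) (fun g => ⟨fun hg => hHmul (hσH hA) hg, fun hg => by
      have := hHmul (hHinv (hσH hA)) hg
      simpa using this⟩) (fun g _ => rfl)
  constructor
  · have h1 := Finset.sum_congr (s₁ := H) rfl fun g hg => heq g hg A hA i
    rw [Finset.sum_add_distrib, Finset.sum_add_distrib, hsum, Finset.sum_const, Finset.sum_const,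
      nsmul_eq_mul, nsmul_eq_mul] at h1
    field_simp
    linarith
  · intro j hj
    rcases eq_or_ne (A i j) 0 with h0 | h0
    · rw [h0, zero_mul]; exact ofReal_pos _
    · obtain ⟨x, hx⟩ := exists_eq_ofReal h0
      have h1 : ∑ g ∈ H, (x + f (σ A * g) j) < ∑ g ∈ H, (mean a A + f g i) :=
        Finset.sum_lt_sum_of_nonempty (Finset.card_pos.1 (Nat.cast_pos.1 hHcard))
          fun g hg => hlt g hg A hA i j hj x hx
      rw [Finset.sum_add_distrib, Finset.sum_add_distrib, hsum, Finset.sum_const, Finset.sum_const,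
        nsmul_eq_mul, nsmul_eq_mul] at h1
      rw [hx, ← ofReal_add, ofReal_lt_ofReal]
      rw [← mul_lt_mul_iff_right₀ hHcard, mul_add, mul_add, mul_div_cancel₀ _ hHcard.ne',
        mul_div_cancel₀ _ hHcard.ne']
      exact h1

end DominantSystem

/-! ### Semigroups with a common strict potential -/

open Filter Topology in
-- Finitely many strict inequalities have a common margin; entries `-∞` impose nothing.
theorem exists_pos_forall_le {G : Set (Mat n n)} (hG : G.Finite)
    {p : Mat n n → Fin n → Fin n → Prop}
    {x : Mat n n → Fin n → Fin n → MaxPlus} {y : Mat n n → Fin n → ℝ}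
    (h : ∀ A ∈ G, ∀ i j, p A i j → x A i j < ofReal (y A i)) :
    ∃ δ : ℝ, 0 < δ ∧ ∀ A ∈ G, ∀ i j, p A i j → x A i j ≤ ofReal (y A i - δ) := by
  have hev : ∀ᶠ δ in 𝓝[>] (0 : ℝ), ∀ A ∈ G, ∀ i j, p A i j → x A i j ≤ ofReal (y A i - δ) := by
    refine (eventually_all_finite hG).2 fun A hA => eventually_all.2 fun i =>
      eventually_all.2 fun j => eventually_imp_distrib_left.2 fun hp => ?_
    have hlt := h A hA i j hp
    rcases eq_or_ne (x A i j) 0 with h0 | h0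
    · exact Eventually.of_forall fun δ => by rw [h0]; exact zero_le
    · obtain ⟨z, hz⟩ := exists_eq_ofReal h0
      rw [hz, ofReal_lt_ofReal] at hlt
      filter_upwards [Ioo_mem_nhdsGT (sub_pos.2 hlt)] with δ hδ
      rw [hz, ofReal_le_ofReal]
      linarith [hδ.2]
  obtain ⟨δ, hδ, hpos⟩ := (hev.and self_mem_nhdsWithin).exists
  exact ⟨δ, hpos, hδ⟩

/-- After conjugation by the diagonal matrix of `e` and scaling, `A` has the entry `0` along a
permutation, and all other entries are at most `-δ`. -/
def IsNearPermutation (e : Fin n → ℝ) (δ : ℝ) (A : Mat n n) : Prop :=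
  ∃ (σ : Equiv.Perm (Fin n)) (l : ℝ), (∀ i, A i (σ i) * ofReal (e (σ i)) = ofReal (l + e i)) ∧
    ∀ i j, j ≠ σ i → A i j * ofReal (e j) ≤ ofReal (l + e i - δ)

namespace IsNearPermutation

variable {e : Fin n → ℝ} {δ : ℝ} {A B : Mat n n}

/-- In the coordinates given by `e`, a product path leaving the composed permutation leaves it at
some factor, losing at least `δ`. -/
protected theorem mul (hδ : 0 ≤ δ) (hA : IsNearPermutation e δ A) (hB : IsNearPermutation e δ B) :
    IsNearPermutation e δ (A * B) := by
  obtain ⟨σ, l, h1, h2⟩ := hA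
  obtain ⟨τ, l', h1', h2'⟩ := hB
  have hAle : ∀ i j, A i j * ofReal (e j) ≤ ofReal (l + e i) := fun i j => by
    rcases eq_or_ne j (σ i) with rfl | hj
    · exact (h1 i).le
    · exact (h2 i j hj).trans (ofReal_le_ofReal.2 (by linarith))
  have hBle : ∀ i j, B i j * ofReal (e j) ≤ ofReal (l' + e i) := fun i j => by
    rcases eq_or_ne j (τ i) with rfl | hj
    · exact (h1' i).le
    · exact (h2' i j hj).trans (ofReal_le_ofReal.2 (by linarith))
  have hstep : ∀ (c : ℝ) (i k j : Fin n) (x : ℝ), B k j * ofReal (e j) ≤ ofReal (c + e k) →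
      A i k * ofReal (e k) ≤ ofReal x → A i k * B k j * ofReal (e j) ≤ ofReal (c + x) := by
    intro c i k j x hb ha
    calc A i k * B k j * ofReal (e j) = A i k * (B k j * ofReal (e j)) := mul_assoc _ _ _
      _ ≤ A i k * ofReal (c + e k) := mul_le_mul_right hb _
      _ = ofReal c * (A i k * ofReal (e k)) := by rw [ofReal_add]; ring
      _ ≤ ofReal (c + x) := by rw [ofReal_add]; exact mul_le_mul_right ha _
  refine ⟨τ * σ, l + l', fun i => le_antisymm ?_ ?_, fun i j hj => ?_⟩
  · rw [Matrix.mul_apply, Finset.sum_mul, sum_le_iff]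
    intro k _
    refine (hstep l' i k _ _ (hBle k _) (hAle i k)).trans (ofReal_le_ofReal.2 (by linarith))
  · refine le_trans ?_ (mul_le_mul_left (mul_apply_ge A B i (σ i) _) _)
    rw [Equiv.Perm.mul_apply, mul_assoc, h1', ofReal_add l', mul_left_comm, h1, ← ofReal_add,
      ofReal_le_ofReal]
    linarith
  · rw [Matrix.mul_apply, Finset.sum_mul, sum_le_iff]
    intro k _
    by_cases hk : k = σ i
    · have hj' : j ≠ τ k := by rw [hk]; exact hj
      have hb : B k j * ofReal (e j) ≤ ofReal (l' - δ + e k) :=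
        (h2' k j hj').trans (ofReal_le_ofReal.2 (by linarith))
      exact (hstep _ i k j _ hb (hAle i k)).trans (ofReal_le_ofReal.2 (by linarith))
    · exact (hstep _ i k j _ (hBle k j) (h2 i k hk)).trans (ofReal_le_ofReal.2 (by linarith))

protected theorem pow (hδ : 0 ≤ δ) (hA : IsNearPermutation e δ A) {k : ℕ} (hk : 1 ≤ k) :
    IsNearPermutation e δ (A ^ k) := by
  induction k, hk using Nat.le_induction with
  | base => rwa [pow_one]
  | succ k _ ih => rw [pow_succ]; exact ih.mul hδ hA

theorem exists_dominant (hδ : 0 < δ) (hA : IsNearPermutation e δ A) :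
    ∃ σ u v, Dominant σ u v A := by
  obtain ⟨σ, l, h1, h2⟩ := hA
  have hcancel : ∀ (y : MaxPlus) (x : ℝ), y = y * ofReal x * ofReal (-x) := fun y x => by
    rw [mul_assoc, ← ofReal_add, add_neg_cancel, ofReal_zero, mul_one]
  refine ⟨σ, fun i => ofReal (l + e i), fun j => ofReal (-e j), fun _ => ofReal_ne_zero _,
    fun _ => ofReal_ne_zero _, fun i => ?_, fun i j hj => ?_⟩
  · rw [hcancel (A i (σ i)) (e (σ i)), h1]
  · rw [hcancel (A i j) (e j)]
    refine mul_lt_mul_of_pos_right ((h2 i j hj).trans_lt ?_) (ofReal_pos _)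
    rw [ofReal_lt_ofReal]
    linarith

theorem ne_zero (hn : 0 < n) (hA : IsNearPermutation e δ A) : A ≠ 0 := by
  rintro rfl
  obtain ⟨σ, l, h, -⟩ := hA
  have := h ⟨0, hn⟩
  rw [Matrix.zero_apply, zero_mul] at this
  exact ofReal_ne_zero _ this.symm

theorem of_proj_mem_closure (hn : 0 < n) {T : Set (Mat n n)}
    (hT : ∀ A ∈ T, IsNearPermutation e δ A) (hB : proj B ∈ closure (proj '' T)) :
    IsNearPermutation e δ B := by
  -- The scale `l` is eliminated by comparing rows, and products replace differences. The conditions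
  -- become closed, invariant under scaling and meaningful at `-∞`.
  let F : Set (Mat n n) := {A | ∃ σ : Equiv.Perm (Fin n),
    (∀ i i', A i (σ i) * ofReal (e (σ i)) * ofReal (e i') =
      A i' (σ i') * ofReal (e (σ i')) * ofReal (e i)) ∧
    ∀ i j, j ≠ σ i → A i j * ofReal (e j) * ofReal δ ≤ A i (σ i) * ofReal (e (σ i))}
  have hentry : ∀ i j, Continuous fun A : Mat n n => A i j := fun i j =>
    continuous_id.matrix_elem i j
  have hF : IsClosed F := by
    simp only [F, Set.ofPred_exists]
    refine isClosed_iUnion_of_finite fun σ => IsClosed.and ?_ ?_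
    · simp only [Set.ofPred_forall]
      refine isClosed_iInter fun i => isClosed_iInter fun i' => isClosed_eq ?_ ?_
      · exact ((hentry _ _).mul continuous_const).mul continuous_const
      · exact ((hentry _ _).mul continuous_const).mul continuous_const
    · simp only [Set.ofPred_forall]
      refine isClosed_iInter fun i => isClosed_iInter fun j => isClosed_iInter fun _ =>
        isClosed_le ?_ ?_
      · exact ((hentry _ _).mul continuous_const).mul continuous_const
      · exact (hentry _ _).mul continuous_const
  have hscale : ∀ A ∈ F, ∀ c : ℝ, ofReal c • A ∈ F := by
    rintro A ⟨σ, h1, h2⟩ c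
    refine ⟨σ, fun i i' => ?_, fun i j hj => ?_⟩
    · simp only [Matrix.smul_apply, smul_eq_mul, mul_assoc] at h1 ⊢
      rw [h1 i i']
    · have := h2 i j hj
      simp only [Matrix.smul_apply, smul_eq_mul, mul_assoc] at this ⊢
      exact mul_le_mul_right this _
  have hTF : ∀ A ∈ T, A ∈ F ∧ A ≠ 0 := by
    intro A hA
    refine ⟨?_, (hT A hA).ne_zero hn⟩
    obtain ⟨σ, l, h1, h2⟩ := hT A hA
    refine ⟨σ, fun i i' => ?_, fun i j hj => ?_⟩
    · rw [h1, h1, ← ofReal_add, ← ofReal_add]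
      congr 1
      ring
    · rw [h1]
      refine (mul_le_mul_left (h2 i j hj) _).trans_eq ?_
      rw [← ofReal_add]
      congr 1
      ring
  obtain ⟨⟨σ, h1, h2⟩, hB0⟩ := mem_of_proj_mem_closure hF hscale hTF hB
  -- One dominant entry `-∞` would force all of them, and then the whole matrix, to be `-∞`.
  have hne : ∀ i, B i (σ i) * ofReal (e (σ i)) ≠ 0 := by
    intro i h0
    have hall : ∀ i', B i' (σ i') * ofReal (e (σ i')) = 0 := fun i' => by
      have := h1 i i'
      rw [h0, zero_mul] at this
      exact (mul_eq_zero.1 this.symm).resolve_right (ofReal_ne_zero _)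
    refine hB0 (Matrix.ext fun i' j => ?_)
    rcases eq_or_ne j (σ i') with rfl | hj
    · exact (mul_eq_zero.1 (hall i')).resolve_right (ofReal_ne_zero _)
    · have := h2 i' j hj
      rw [hall i', le_zero_iff, mul_assoc] at this
      exact (mul_eq_zero.1 this).resolve_right
        (mul_ne_zero (ofReal_ne_zero _) (ofReal_ne_zero _))
  obtain ⟨x, hx⟩ := exists_eq_ofReal (hne ⟨0, hn⟩)
  have heq : ∀ i, B i (σ i) * ofReal (e (σ i)) = ofReal (x - e ⟨0, hn⟩ + e i) := fun i => by
    obtain ⟨y, hy⟩ := exists_eq_ofReal (hne i)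
    have := h1 ⟨0, hn⟩ i
    rw [hx, hy, ← ofReal_add, ← ofReal_add, ofReal_inj] at this
    rw [hy, ofReal_inj]
    linarith
  refine ⟨σ, x - e ⟨0, hn⟩, heq, fun i j hj => ?_⟩
  have := h2 i j hj
  rw [heq] at this
  have h3 := mul_le_mul_left this (ofReal (-δ))
  rwa [mul_assoc, ← ofReal_add, add_neg_cancel, ofReal_zero, mul_one, ← ofReal_add,
    ← sub_eq_add_neg] at h3

theorem urk_eq (hn : 0 < n) (hδ : 0 < δ) (hA : IsNearPermutation e δ A) (t : RankNotion) :
    urk t A = n := by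
  obtain ⟨B, hB, hr⟩ := Nat.sInf_mem (s := {r | ∃ B : Mat n n,
    proj B ∈ closure {x | ∃ k : ℕ, 1 ≤ k ∧ x = proj (A ^ k)} ∧ rk t B = r})
    ⟨_, A, subset_closure ⟨1, le_rfl, by rw [pow_one]⟩, rfl⟩
  have hB' : IsNearPermutation e δ B := by
    refine of_proj_mem_closure hn (T := {Q | ∃ k : ℕ, 1 ≤ k ∧ Q = A ^ k}) ?_
      (closure_mono ?_ hB)
    · rintro _ ⟨k, hk, rfl⟩
      exact hA.pow hδ.le hk
    · rintro _ ⟨k, hk, rfl⟩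
      exact ⟨A ^ k, ⟨k, hk, rfl⟩, rfl⟩
  obtain ⟨σ, u, v, hd⟩ := hB'.exists_dominant hδ
  exact hr.symm.trans (hd.rk_eq t)

end IsNearPermutation

theorem exists_isNearPermutation (hn : 0 < n) {S : Subsemigroup (Mat n n)}
    (hne : (S : Set (Mat n n)).Nonempty)
    (hfg : ∃ G : Set (Mat n n), G.Finite ∧ Subsemigroup.closure G = S)
    (hS : ∀ P ∈ S, NoRedundantLimit P) :
    ∃ (e : Fin n → ℝ) (δ : ℝ), 0 < δ ∧ ∀ A ∈ S, IsNearPermutation e δ A := by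
  obtain ⟨G, hG, hGS⟩ := hfg
  have hGS' : G ⊆ S := by rw [← hGS]; exact Subsemigroup.subset_closure
  obtain ⟨σ, a, h⟩ := exists_dominantSystem hn hS
  obtain ⟨e, he⟩ := h.exists_common_potential hne hG hGS'
  obtain ⟨δ, hδ, hle⟩ := exists_pos_forall_le hG (p := fun A i j => j ≠ σ A i)
    (x := fun A i j => A i j * ofReal (e j)) (y := fun A i => DominantSystem.mean a A + e i)
    fun A hA i j hj => (he A hA i).2 j hj
  refine ⟨e, δ, hδ, fun A hA => ?_⟩
  rw [← hGS] at hA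
  induction hA using Subsemigroup.closure_induction with
  | mem A hA =>
    refine ⟨σ A, DominantSystem.mean a A, fun i => ?_, hle A hA⟩
    rw [h.apply_eq A (hGS' hA), ← ofReal_add, (he A hA i).1]
  | mul A B _ _ hA hB => exact hA.mul hδ.le hB

/-! ### Comparison of ultimate ranks and conclusion -/

theorem urk_pow_eq {t : RankNotion} {P : Mat n n} (h : urk t P = n) {k : ℕ} (hk : 1 ≤ k) :
    urk t (P ^ k) = n := by
  obtain ⟨B, hB, hr⟩ := Nat.sInf_mem (s := {r | ∃ B : Mat n n,
    proj B ∈ closure {x | ∃ l : ℕ, 1 ≤ l ∧ x = proj ((P ^ k) ^ l)} ∧ rk t B = r})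
    ⟨_, P ^ k, subset_closure ⟨1, le_rfl, by rw [pow_one]⟩, rfl⟩
  refine hr.symm.trans (le_antisymm (rk_le t B) (h.symm.trans_le (Nat.sInf_le ⟨B, ?_, rfl⟩)))
  refine closure_mono ?_ hB
  rintro _ ⟨l, hl, rfl⟩
  exact ⟨k * l, Nat.mul_pos hk hl, by rw [pow_mul]⟩

/-- The ultimate rank of a matrix is maximal for one notion of rank if and only if it is for
every other one. -/
theorem urk_eq_of_urk_eq (hn : 0 < n) {s t : RankNotion} {P : Mat n n} (h : urk s P = n) :
    urk t P = n := by
  have hmem : ∀ A ∈ Subsemigroup.closure {P}, ∃ k, 1 ≤ k ∧ A = P ^ k := by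
    intro A hA
    induction hA using Subsemigroup.closure_induction with
    | mem A hA => exact ⟨1, le_rfl, by rw [pow_one]; exact hA⟩
    | mul A B _ _ hA hB =>
      obtain ⟨k, hk, rfl⟩ := hA
      obtain ⟨l, hl, rfl⟩ := hB
      exact ⟨k + l, by omega, (pow_add P k l).symm⟩
  have hP : P ∈ Subsemigroup.closure {P} := Subsemigroup.subset_closure rfl
  -- The semigroup result is applied to a single generator, whose powers inherit maximal ultimate
  -- rank.
  obtain ⟨e, δ, hδ, hall⟩ := exists_isNearPermutation hn (S := Subsemigroup.closure {P}) ⟨P, hP⟩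
    ⟨{P}, Set.finite_singleton P, rfl⟩ fun A hA => by
      obtain ⟨k, hk, rfl⟩ := hmem A hA
      exact noRedundantLimit_of_urk_eq (urk_pow_eq h hk)
  exact (hall P hP).urk_eq hn hδ t

theorem urk_le (t : RankNotion) (A : Mat n n) : urk t A ≤ n :=
  le_trans (Nat.sInf_le ⟨A, subset_closure ⟨1, le_rfl, by rw [pow_one]⟩, rfl⟩) (rk_le t A)

theorem urk_eq_of_semigroupUrk_eq {s : RankNotion} {S : Subsemigroup (Mat n n)}
    (h : semigroupUrk s S = n) {P : Mat n n} (hP : P ∈ S) : urk s P = n := by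
  obtain ⟨B, hB, hr⟩ := Nat.sInf_mem (s := {r | ∃ B : Mat n n,
    proj B ∈ closure {x | ∃ k : ℕ, 1 ≤ k ∧ x = proj (P ^ k)} ∧ rk s B = r})
    ⟨_, P, subset_closure ⟨1, le_rfl, by rw [pow_one]⟩, rfl⟩
  refine hr.symm.trans (le_antisymm (rk_le s B) (h.symm.trans_le (Nat.sInf_le ⟨B, ?_, rfl⟩)))
  refine closure_mono ?_ hB
  rintro _ ⟨k, hk, rfl⟩
  refine ⟨P ^ k, ?_, rfl⟩
  induction k, hk using Nat.le_induction with
  | base => rwa [pow_one]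
  | succ k _ ih => rw [pow_succ]; exact S.mul_mem ih hP

theorem urk_eq_of_semigroupMinUrk_eq {s : RankNotion} {S : Subsemigroup (Mat n n)}
    (h : semigroupMinUrk s S = n) {P : Mat n n} (hP : P ∈ S) : urk s P = n :=
  le_antisymm (urk_le s P)
    (h.symm.trans_le (Nat.sInf_le ⟨P, subset_closure ⟨P, hP, rfl⟩, rfl⟩))

theorem semigroupUrk_le (s : RankNotion) {S : Subsemigroup (Mat n n)}
    (hne : (S : Set (Mat n n)).Nonempty) : semigroupUrk s S ≤ n := by
  obtain ⟨A, hA⟩ := hne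
  exact le_trans (Nat.sInf_le ⟨A, subset_closure ⟨A, hA, rfl⟩, rfl⟩) (rk_le s A)

theorem semigroupMinUrk_le (s : RankNotion) {S : Subsemigroup (Mat n n)}
    (hne : (S : Set (Mat n n)).Nonempty) : semigroupMinUrk s S ≤ n := by
  obtain ⟨A, hA⟩ := hne
  exact le_trans (Nat.sInf_le ⟨A, subset_closure ⟨A, hA, rfl⟩, rfl⟩) (urk_le s A)

theorem semigroupUrk_eq (hn : 0 < n) {s t : RankNotion} {S : Subsemigroup (Mat n n)}
    (hne : (S : Set (Mat n n)).Nonempty)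
    (hfg : ∃ G : Set (Mat n n), G.Finite ∧ Subsemigroup.closure G = S)
    (h : ∀ P ∈ S, urk t P = n) : semigroupUrk s S = n ∧ semigroupMinUrk s S = n := by
  obtain ⟨e, δ, hδ, hall⟩ := exists_isNearPermutation hn hne hfg
    fun P hP => noRedundantLimit_of_urk_eq (h P hP)
  have hB : ∀ B : Mat n n, proj B ∈ closure (proj '' (S : Set (Mat n n))) →
      IsNearPermutation e δ B := fun B hB =>
    IsNearPermutation.of_proj_mem_closure hn hall hB
  obtain ⟨A, hA⟩ := hne
  have hA' : proj A ∈ closure (proj '' (S : Set (Mat n n))) := subset_closure ⟨A, hA, rfl⟩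
  constructor
  · obtain ⟨B, hBS, hr⟩ := Nat.sInf_mem (s := {r | ∃ A : Mat n n,
      proj A ∈ closure (proj '' (S : Set (Mat n n))) ∧ rk s A = r}) ⟨_, A, hA', rfl⟩
    obtain ⟨σ, u, v, hd⟩ := (hB B hBS).exists_dominant hδ
    exact hr.symm.trans (hd.rk_eq s)
  · obtain ⟨B, hBS, hr⟩ := Nat.sInf_mem (s := {r | ∃ A : Mat n n,
      proj A ∈ closure (proj '' (S : Set (Mat n n))) ∧ urk s A = r}) ⟨_, A, hA', rfl⟩
    exact hr.symm.trans ((hB B hBS).urk_eq hn hδ s)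

end MaxPlus

end

theorem lemma6p3 (n : ℕ) (S : Subsemigroup (MaxPlus.Mat n n))
    (hne : (S : Set (MaxPlus.Mat n n)).Nonempty)
    (hfg : ∃ G : Set (MaxPlus.Mat n n), G.Finite ∧ Subsemigroup.closure G = S)
    (s t : MaxPlus.RankNotion) :
    (MaxPlus.semigroupUrk s S = n ↔ ∀ P ∈ S, MaxPlus.urk t P = n) ∧
      (MaxPlus.semigroupMinUrk s S = n ↔ ∀ P ∈ S, MaxPlus.urk t P = n) := by
  -- In size zero all ranks are at most zero and every claim holds; the potential argument needs an
  -- index.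
  rcases Nat.eq_zero_or_pos n with rfl | hn
  · have h1 := MaxPlus.semigroupUrk_le s hne
    have h2 := MaxPlus.semigroupMinUrk_le s hne
    have h3 : ∀ P ∈ S, MaxPlus.urk t P = 0 := fun P _ => Nat.le_zero.1 (MaxPlus.urk_le t P)
    exact ⟨iff_of_true (Nat.le_zero.1 h1) h3, iff_of_true (Nat.le_zero.1 h2) h3⟩
  · exact ⟨⟨fun h P hP => MaxPlus.urk_eq_of_urk_eq hn (MaxPlus.urk_eq_of_semigroupUrk_eq h hP),
        fun h => (MaxPlus.semigroupUrk_eq hn hne hfg h).1⟩,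
      ⟨fun h P hP => MaxPlus.urk_eq_of_urk_eq hn (MaxPlus.urk_eq_of_semigroupMinUrk_eq h hP),
        fun h => (MaxPlus.semigroupUrk_eq hn hne hfg h).2⟩⟩
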